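/- Let $K$ be an algebraically closed field of characteristic zero with an absolute value $|\cdot|$, and let "convergent" refer to $|\cdot|$: a series $\sum c_wX^w$ is convergent if $\sum |c_w|r^{w_1+\dots+w_d}<\infty$ for some $r>0$. (For $K=\mathbb C$ with the usual absolute value this is the complex analytic category; for the trivial absolute value every formal power series in $X_1^{1/n},\dots,X_d^{1/n}$ is convergent, and this is the algebroid category.) For a semigroup $\Lambda\subset\mathbb Q_{\ge 0}^d$ let $K\{\Lambda\}$ be the ring of convergent power series with exponents in $\Lambda$. Let $(S,0)$ be an irreducible quasi-ordinary hypersurface germ of dimension $d$, defined by an irreducible quasi-ordinary polynomial $f\in K\{X_1,\dots,X_d\}[Y]$, that is, a Weierstrass polynomial whose discriminant is a monomial $X^\delta$ times a unit. Its characteristic exponents are the vectors $\lambda\in\mathbb Q^d$ such that $\zeta-\zeta'=X^{\lambda}\cdot\text{unit}$ for two roots $\zeta,\zeta'\in K\{X_1^{1/n},\dots,X_d^{1/n}\}$ of $f$, where $n=\deg f$. They are finite in number and totally ordered by the coordinatewise order, $\lambda_1\prec\dots\prec\lambda_g$. Put $M_0=\mathbb Z^d$ with canonical basis $e_1,\dots,e_d$,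 $M_j=M_{j-1}+\mathbb Z\lambda_j$, $M=M_g$, $n_j=[M_j:M_{j-1}]$, $\overline\lambda_1=\lambda_1$, $\overline\lambda_{j+1}=n_j\overline\lambda_j+\lambda_{j+1}-\lambda_j$. Let $\Gamma$ be the semigroup generated by $\gamma_1,\dots,\gamma_{d+g}:=e_1,\dots,e_d,\overline\lambda_1,\dots,\overline\lambda_g$, let $Z^\Gamma=\operatorname{Spec}K[\Gamma]\subset\mathbb A^{d+g}$ (embedded by $U_i=X^{\gamma_i}$) be the monomial variety, $(S_0,0)=(Z^\Gamma,0)$ its germ at the origin, with local ring $\mathcal O_{S_0}=K\{\Gamma\}$, and $Z$ its normalization, with local ring $\mathcal O_Z=K\{\sigma^\vee\cap M\}$, $\sigma^\vee=\mathbb R^d_{\ge0}$. The Jacobian ideal $\mathrm{Jac}$ of $Z^\Gamma$ (of $S_0$) is the ideal of its coordinate ring (local ring) generated by the minors of order $g$ of the Jacobian matrices of elements of the ideal defining it in $\mathbb A^{d+g}$ (in the germ of $\mathbb A^{d+g}$ at $0$). Let $$\gamma_0=\sum_{j=1}^g(n_j-1)\overline\lambda_j-\sum_{i=1}^d e_i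 .$$ (1) $\gamma_0$ is the minimal Frobenius vector of $\Gamma$: $\gamma_0\in M$; $\gamma_0+\alpha\in\Gamma$ for all $\alpha\in M$ with all coordinates positive; and every other vector of $M$ with this property lies in $\gamma_0+\sigma^\vee$. (2) For the affine variety, $\mathrm{Jac}(Z^\Gamma)=X^{\gamma_0}\,\mathcal J_{\log}(Z^\Gamma)$, where $\mathcal J_{\log}(Z^\Gamma)\subset K[\Gamma]$ is the ideal generated by the monomials $X^{\gamma_{j_1}+\dots+\gamma_{j_d}}$ with $j_1<\dots<j_d$ and $\gamma_{j_1}\wedge\dots\wedge\gamma_{j_d}\neq0$. (3) For the germ, $$\mathrm{Jac}(S_0)\,\mathcal O_Z=X^{\gamma_0}\,\mathcal J_{\log}(S_0)\,\mathcal O_Z=X^{\gamma_0}\,\mathcal I_g ,$$ where $\mathcal I_g\subset\mathcal O_Z$ is the ideal generated by the same monomials as in (2), and $\mathcal J_{\log}(S_0)\mathcal O_Z$ is the ideal generated by the image of $\Omega^d_{S_0}\to\Omega^d_Z\to\Omega^d_Z(\log D)=\mathcal O_Z\otimes\bigwedge^dM\cong\mathcal O_Z$, $D$ being the complement of the torus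 in $Z$ and the second map being induced by $dX^w\mapsto X^w\otimes w$. -/

import Mathlib

open scoped BigOperators

noncomputable section

namespace QuasiOrdinary

/-! ### Power series with rational exponents -/

/-- The ambient ring of generalized power series `∑ c_w X^w` with exponents `w ∈ ℚ^d`
(ordered coordinatewise).  All rings of fractional power series in `X_1, …, X_d` used below are
subalgebras of it, and it contains the monomials `X^w` for every `w ∈ ℚ^d`. -/
abbrev QSeries (K : Type*) [Field K] (d : ℕ) : Type _ := HahnSeries (Fin d → ℚ) K

/-- The monomial `X^w`. -/
def mono (K : Type*) [Field K] {d : ℕ} (w : Fin d → ℚ) : QSeries K d := HahnSeries.single w 1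

section Convergence

variable {K : Type*} [Field K] (v : AbsoluteValue K ℝ) {d : ℕ}

/-- Convergence of `∑ c_w X^w`: for some `r > 0` one has `∑ |c_w| r^{w_1 + ⋯ + w_d} < ∞`.
For `K = ℂ` with the usual absolute value this is convergence near the origin; for the trivial
absolute value every formal power series in `X_1^{1/n}, …, X_d^{1/n}` is convergent
(take `r = 1/2`), so that case is the formal one. -/
def Converges (F : QSeries K d) : Prop :=
  ∃ r : ℝ, 0 < r ∧ Summable fun w : Fin d → ℚ => v (F.coeff w) * r ^ ((∑ i, w i : ℚ) : ℝ)

/-- Convergence of an ordinary power series `∑ c_α U^α` in finitely many variables. -/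
def MvConverges {m : ℕ} (F : MvPowerSeries (Fin m) K) : Prop :=
  ∃ r : ℝ, 0 < r ∧ Summable fun α : Fin m →₀ ℕ => v (MvPowerSeries.coeff α F) * r ^ α.degree

variable {v}

theorem Converges.exists_le {F : QSeries K d} (hF : Converges v F)
    (h0 : ∀ w ∈ F.support, 0 ≤ w) :
    ∃ r : ℝ, 0 < r ∧ ∀ s : ℝ, 0 < s → s ≤ r →
      Summable fun w : Fin d → ℚ => v (F.coeff w) * s ^ ((∑ i, w i : ℚ) : ℝ) := by
  obtain ⟨r, hr, hs⟩ := hF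
  refine ⟨r, hr, fun s hs0 hsr => Summable.of_nonneg_of_le (fun w => ?_) (fun w => ?_) hs⟩
  · exact mul_nonneg (v.nonneg _) (Real.rpow_nonneg hs0.le _)
  · by_cases hw : F.coeff w = 0
    · simp [hw]
    · have hw0 : 0 ≤ ∑ i, w i := Finset.sum_nonneg fun i _ => h0 w hw i
      exact mul_le_mul_of_nonneg_left
        (Real.rpow_le_rpow hs0.le hsr (by exact_mod_cast hw0)) (v.nonneg _)

theorem Converges.add {F G : QSeries K d} (hF : Converges v F) (hG : Converges v G)
    (hF0 : ∀ w ∈ F.support, 0 ≤ w) (hG0 : ∀ w ∈ G.support, 0 ≤ w) : Converges v (F + G) := by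
  obtain ⟨r, hr, h1⟩ := hF.exists_le hF0
  obtain ⟨s, hs, h2⟩ := hG.exists_le hG0
  have ht : 0 < min r s := lt_min hr hs
  refine ⟨min r s, ht, Summable.of_nonneg_of_le (fun w => ?_) (fun w => ?_)
    ((h1 _ ht (min_le_left _ _)).add (h2 _ ht (min_le_right _ _)))⟩
  · exact mul_nonneg (v.nonneg _) (Real.rpow_nonneg ht.le _)
  · rw [← add_mul]
    exact mul_le_mul_of_nonneg_right (by simpa using v.add_le _ _) (Real.rpow_nonneg ht.le _)

theorem Converges.mul {F G : QSeries K d} (hF : Converges v F) (hG : Converges v G)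
    (hF0 : ∀ w ∈ F.support, 0 ≤ w) (hG0 : ∀ w ∈ G.support, 0 ≤ w) : Converges v (F * G) := by
  classical
  obtain ⟨r, hr, h1⟩ := hF.exists_le hF0
  obtain ⟨s, hs, h2⟩ := hG.exists_le hG0
  have ht : 0 < min r s := lt_min hr hs
  set t := min r s
  have h1' := h1 t ht (min_le_left _ _)
  have h2' := h2 t ht (min_le_right _ _)
  have hp := h1'.mul_of_nonneg h2' (fun w => mul_nonneg (v.nonneg _) (Real.rpow_nonneg ht.le _))
    (fun w => mul_nonneg (v.nonneg _) (Real.rpow_nonneg ht.le _))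
  have hpn : ∀ x : (Fin d → ℚ) × (Fin d → ℚ), 0 ≤
      (v (F.coeff x.1) * t ^ ((∑ i, x.1 i : ℚ) : ℝ)) *
        (v (G.coeff x.2) * t ^ ((∑ i, x.2 i : ℚ) : ℝ)) := fun x => by
    have := v.nonneg (F.coeff x.1)
    have := v.nonneg (G.coeff x.2)
    positivity
  refine ⟨t, ht, summable_of_sum_le (c := ∑' x : (Fin d → ℚ) × (Fin d → ℚ),
      (v (F.coeff x.1) * t ^ ((∑ i, x.1 i : ℚ) : ℝ)) *
        (v (G.coeff x.2) * t ^ ((∑ i, x.2 i : ℚ) : ℝ)))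
    (fun w => mul_nonneg (v.nonneg _) (Real.rpow_nonneg ht.le _)) (fun u => ?_)⟩
  calc _ ≤ ∑ w ∈ u, ∑ x ∈ Finset.antidiagonal F.isPWO_support G.isPWO_support w,
        (v (F.coeff x.1) * t ^ ((∑ i, x.1 i : ℚ) : ℝ)) *
          (v (G.coeff x.2) * t ^ ((∑ i, x.2 i : ℚ) : ℝ)) := by
        refine Finset.sum_le_sum fun w _ => ?_
        rw [HahnSeries.coeff_mul]
        refine (mul_le_mul_of_nonneg_right (v.sum_le _ _) (Real.rpow_nonneg ht.le _)).trans ?_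
        rw [Finset.sum_mul]
        refine Finset.sum_le_sum fun x hx => le_of_eq ?_
        have hxw : x.1 + x.2 = w := (Finset.mem_antidiagonal.1 hx).2.2
        have : ((∑ i, w i : ℚ) : ℝ) = ((∑ i, x.1 i : ℚ) : ℝ) + ((∑ i, x.2 i : ℚ) : ℝ) := by
          rw [← hxw]; push_cast; simp [Finset.sum_add_distrib]
        rw [this, Real.rpow_add ht, map_mul]
        ring
    _ = ∑ x ∈ u.biUnion fun w => Finset.antidiagonal F.isPWO_support G.isPWO_support w,
        (v (F.coeff x.1) * t ^ ((∑ i, x.1 i : ℚ) : ℝ)) *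
          (v (G.coeff x.2) * t ^ ((∑ i, x.2 i : ℚ) : ℝ)) := by
        rw [Finset.sum_biUnion]
        intro a _ b _ hab
        refine Finset.disjoint_left.2 fun x hx hx' => hab ?_
        rw [← (Finset.mem_antidiagonal.1 hx).2.2, ← (Finset.mem_antidiagonal.1 hx').2.2]
    _ ≤ _ := hp.sum_le_tsum _ (fun x _ => hpn x)

end Convergence

/-- The local ring `K{Λ}` of convergent power series with exponents in `Λ ∩ ℚ^d_{≥0}`, for a
semigroup `Λ ⊆ ℚ^d` (with zero). -/
def germRing (K : Type*) [Field K] (v : AbsoluteValue K ℝ) {d : ℕ}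
    (Λ : AddSubmonoid (Fin d → ℚ)) : Subalgebra K (QSeries K d) where
  carrier := {F | (∀ w ∈ F.support, w ∈ Λ ∧ 0 ≤ w) ∧ Converges v F}
  mul_mem' := by
    rintro F G ⟨hF, hFc⟩ ⟨hG, hGc⟩
    refine ⟨fun w hw => ?_, hFc.mul hGc (fun w h => (hF w h).2) (fun w h => (hG w h).2)⟩
    obtain ⟨a, ha, b, hb, rfl⟩ := HahnSeries.support_mul_subset hw
    exact ⟨Λ.add_mem (hF a ha).1 (hG b hb).1, add_nonneg (hF a ha).2 (hG b hb).2⟩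
  add_mem' := by
    rintro F G ⟨hF, hFc⟩ ⟨hG, hGc⟩
    refine ⟨fun w hw => ?_, hFc.add hGc (fun w h => (hF w h).2) (fun w h => (hG w h).2)⟩
    rcases HahnSeries.support_add_subset F G hw with h | h
    · exact hF w h
    · exact hG w h
  algebraMap_mem' := by
    intro c
    have hc : algebraMap K (QSeries K d) c = HahnSeries.single 0 c := rfl
    refine ⟨fun w hw => ?_, 1, one_pos, ?_⟩
    · have hw' : w = 0 := by
        by_contra hne
        exact hw (by rw [hc, HahnSeries.coeff_single_of_ne hne])
      subst hw'
      exact ⟨Λ.zero_mem, le_rfl⟩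
    · refine summable_of_ne_finset_zero (s := {0}) fun w hw => ?_
      rw [hc, HahnSeries.coeff_single_of_ne (by simpa using hw)]
      simp

theorem germRing_mono {K : Type*} [Field K] (v : AbsoluteValue K ℝ) {d : ℕ}
    {Λ Λ' : AddSubmonoid (Fin d → ℚ)} (h : Λ ≤ Λ') : germRing K v Λ ≤ germRing K v Λ' :=
  fun _ hF => ⟨fun w hw => ⟨h (hF.1 w hw).1, (hF.1 w hw).2⟩, hF.2⟩

/-- The lattice `(1/n) ℤ^d`. -/
def fracLattice (d n : ℕ) : AddSubgroup (Fin d → ℚ) where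
  carrier := {w | ∀ i, ∃ k : ℤ, (n : ℚ) * w i = k}
  zero_mem' := fun _ => ⟨0, by simp⟩
  add_mem' := by
    intro a b ha hb i
    obtain ⟨k, hk⟩ := ha i
    obtain ⟨l, hl⟩ := hb i
    exact ⟨k + l, by simp [mul_add, hk, hl]⟩
  neg_mem' := by
    intro a ha i
    obtain ⟨k, hk⟩ := ha i
    exact ⟨-k, by simp [hk]⟩

/-- `K{X_1^{1/n}, …, X_d^{1/n}}`; for `n = 1` this is `K{X_1, …, X_d}`. -/
abbrev fracRing (K : Type*) [Field K] (v : AbsoluteValue K ℝ) (d n : ℕ) :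
    Subalgebra K (QSeries K d) :=
  germRing K v (fracLattice d n).toAddSubmonoid

/-! ### Quasi-ordinary polynomials and characteristic exponents -/

section QO

variable {K : Type*} [Field K] (v : AbsoluteValue K ℝ) {d : ℕ}

/-- `f ∈ K{X}[Y]` is a quasi-ordinary polynomial: a Weierstrass polynomial whose discriminant is
a monomial times a unit of `K{X}`. -/
def IsQuasiOrdinary (f : Polynomial (fracRing K v d 1)) : Prop :=
  f.Monic ∧
  (∀ i < f.natDegree, (f.coeff i : QSeries K d).coeff 0 = 0) ∧
  ∃ (δ : Fin d → ℕ) (ε : (fracRing K v d 1)ˣ),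
    (f.discr : QSeries K d) = mono K (fun i => (δ i : ℚ)) * ((ε : fracRing K v d 1) : QSeries K d)

/-- The characteristic exponents of `f`: the exponents `w` such that
`ζ - ζ' = X^w · unit` for two roots `ζ, ζ' ∈ K{X^{1/n}}` of `f`, where `n = deg f`. -/
def charExponents (f : Polynomial (fracRing K v d 1)) : Set (Fin d → ℚ) :=
  {w | ∃ ζ ∈ fracRing K v d f.natDegree, ∃ ζ' ∈ fracRing K v d f.natDegree,
    Polynomial.aeval ζ f = 0 ∧ Polynomial.aeval ζ' f = 0 ∧
    ∃ ε : (fracRing K v d f.natDegree)ˣ,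
      ζ - ζ' = mono K w * ((ε : fracRing K v d f.natDegree) : QSeries K d)}

end QO

/-! ### The semigroup attached to a sequence of exponents -/

section Semigroup

variable {d g : ℕ} (lam : Fin g → Fin d → ℚ)

/-- The lattice `M_k = ℤ^d + ℤ λ_1 + ⋯ + ℤ λ_k` (for `k ≤ g`). -/
def lattice (k : ℕ) : AddSubgroup (Fin d → ℚ) :=
  fracLattice d 1 ⊔ AddSubgroup.closure {w | ∃ i : Fin g, i.val < k ∧ w = lam i}

/-- The lattice `M = M_g`. -/
abbrev topLattice : AddSubgroup (Fin d → ℚ) := lattice lam g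

/-- `charIndex lam k` is the index of `M_k` in `M_{k+1}`, i.e. the integer `n_{k+1}`. -/
def charIndex (k : ℕ) : ℕ := (lattice lam k).relIndex (lattice lam (k + 1))

/-- `lamBarAux lam k` is `λ̄_{k+1}`, defined by `λ̄_1 = λ_1` and
`λ̄_{j+1} = n_j λ̄_j + λ_{j+1} - λ_j`. -/
def lamBarAux : (k : ℕ) → k < g → (Fin d → ℚ)
  | 0, h => lam ⟨0, h⟩
  | k + 1, h =>
      charIndex lam k • lamBarAux k (Nat.lt_of_succ_lt h) + lam ⟨k + 1, h⟩
        - lam ⟨k, Nat.lt_of_succ_lt h⟩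

/-- The vectors `λ̄_1, …, λ̄_g`. -/
def lamBar (j : Fin g) : Fin d → ℚ := lamBarAux lam j.val j.isLt

/-- The generators `γ_1, …, γ_{d+g}`, that is `e_1, …, e_d, λ̄_1, …, λ̄_g`. -/
def gen : Fin (d + g) → Fin d → ℚ :=
  Fin.append (fun i => Pi.single i 1) (lamBar lam)

/-- The semigroup `Γ` generated by `γ_1, …, γ_{d+g}`. -/
def semigroup : AddSubmonoid (Fin d → ℚ) := AddSubmonoid.closure (Set.range (gen lam))

theorem gen_mem_semigroup (i : Fin (d + g)) : gen lam i ∈ semigroup lam :=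
  AddSubmonoid.subset_closure ⟨i, rfl⟩

theorem lam_mem_topLattice (j : Fin g) : lam j ∈ topLattice lam :=
  AddSubgroup.mem_sup_right (AddSubgroup.subset_closure ⟨j, j.isLt, rfl⟩)

theorem lamBarAux_mem_topLattice : ∀ (k : ℕ) (h : k < g), lamBarAux lam k h ∈ topLattice lam
  | 0, h => lam_mem_topLattice lam ⟨0, h⟩
  | k + 1, h => by
      rw [lamBarAux]
      exact sub_mem (add_mem (nsmul_mem (lamBarAux_mem_topLattice k _) _)
        (lam_mem_topLattice lam _)) (lam_mem_topLattice lam _)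

theorem semigroup_le : semigroup lam ≤ (topLattice lam).toAddSubmonoid := by
  refine (AddSubmonoid.closure_le).2 ?_
  rintro _ ⟨i, rfl⟩
  refine Fin.addCases (fun i => ?_) (fun j => ?_) i
  · rw [gen, Fin.append_left]
    refine AddSubgroup.mem_sup_left fun j => ?_
    by_cases h : j = i
    · subst h; exact ⟨1, by simp⟩
    · exact ⟨0, by simp [h]⟩
  · rw [gen, Fin.append_right]
    exact lamBarAux_mem_topLattice lam _ _

/-- The vector `γ_0 = ∑_j (n_j - 1) λ̄_j - ∑_i e_i`. -/
def gammaZero : Fin d → ℚ :=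
  ∑ j : Fin g, ((charIndex lam j : ℚ) - 1) • lamBar lam j - ∑ i : Fin d, Pi.single i 1

/-- `a` is a Frobenius vector of `Γ`: `a ∈ M`, and `a + b ∈ Γ` for all `b ∈ M` in the interior of
the cone `ℝ_{≥0} Γ = ℝ^d_{≥0}`. -/
def IsFrobeniusVector (a : Fin d → ℚ) : Prop :=
  a ∈ topLattice lam ∧ ∀ b ∈ topLattice lam, (∀ i, 0 < b i) → a + b ∈ semigroup lam

/-- `a` is the minimal Frobenius vector: every other one lies in `a + ℝ^d_{≥0}`. -/
def IsMinimalFrobeniusVector (a : Fin d → ℚ) : Prop :=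
  IsFrobeniusVector lam a ∧ ∀ a', IsFrobeniusVector lam a' → a ≤ a'

/-- `γ_{j_1} ∧ ⋯ ∧ γ_{j_d} ≠ 0` for `j_1 < ⋯ < j_d`. -/
def WedgeNeZero (j : Fin d ↪o Fin (d + g)) : Prop :=
  exteriorPower.ιMulti ℚ d (fun a => gen lam (j a)) ≠ 0

end Semigroup

/-! ### The affine toric variety `Z^Γ` -/

section Affine

variable (K : Type*) [Field K] {d g : ℕ} (lam : Fin g → Fin d → ℚ)

/-- The coordinate ring `K[Γ]` of `Z^Γ`. -/
abbrev CoordRing : Type _ := AddMonoidAlgebra K (semigroup lam)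

/-- The embedding `Z^Γ ⊆ 𝔸^{d+g}`: the homomorphism `K[U_1, …, U_{d+g}] → K[Γ]`,
`U_i ↦ X^{γ_i}`. -/
def toricEmbedding : MvPolynomial (Fin (d + g)) K →ₐ[K] CoordRing K lam :=
  MvPolynomial.aeval fun i =>
    AddMonoidAlgebra.single (⟨gen lam i, gen_mem_semigroup lam i⟩ : semigroup lam) (1 : K)

/-- The Jacobian ideal `Jac(Z^Γ) ⊆ K[Γ]`: it is generated by the classes of the minors of order
`g = codim Z^Γ` of the Jacobian matrices of elements of the ideal of `Z^Γ ⊆ 𝔸^{d+g}`. -/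
def affineJacobian : Ideal (CoordRing K lam) :=
  Ideal.span {h | ∃ F : Fin g → MvPolynomial (Fin (d + g)) K,
    (∀ a, toricEmbedding K lam (F a) = 0) ∧ ∃ j : Fin g ↪o Fin (d + g),
      h = toricEmbedding K lam (Matrix.det (Matrix.of fun a b => MvPolynomial.pderiv (j b) (F a)))}

/-- The logarithmic Jacobian ideal `J_log(Z^Γ) ⊆ K[Γ]`. -/
def affineLogJacobian : Ideal (CoordRing K lam) :=
  Ideal.span {h | ∃ j : Fin d ↪o Fin (d + g), WedgeNeZero lam j ∧
    h = AddMonoidAlgebra.single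
      (∑ a, (⟨gen lam (j a), gen_mem_semigroup lam (j a)⟩ : semigroup lam)) (1 : K)}

/-- The inclusion `K[Γ] ⊆ K[ℚ^d]`; the target contains `X^{γ_0}`. -/
def coordInclusion : CoordRing K lam →+* AddMonoidAlgebra K (Fin d → ℚ) :=
  AddMonoidAlgebra.mapDomainRingHom K (semigroup lam).subtype

end Affine

/-! ### The germ `(S_0, 0) = (Z^Γ, 0)` and its normalization `Z` -/

section Germ

variable {K : Type*} [Field K] (v : AbsoluteValue K ℝ) {d g : ℕ} (lam : Fin g → Fin d → ℚ)

/-- `O_{S_0} = K{Γ}`, the local ring of `(Z^Γ, 0)`. -/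
abbrev monomialGerm : Subalgebra K (QSeries K d) := germRing K v (semigroup lam)

/-- `O_Z = K{σ^∨ ∩ M}` with `σ^∨ = ℝ^d_{≥0}`, the local ring of the normalization of
`(Z^Γ, 0)`. -/
abbrev normalizedGerm : Subalgebra K (QSeries K d) :=
  germRing K v (topLattice lam).toAddSubmonoid

/-- The normalization map `O_{S_0} ⊆ O_Z`. -/
def normalization : monomialGerm v lam →ₐ[K] normalizedGerm v lam :=
  Subalgebra.inclusion (germRing_mono v (semigroup_le lam))

/-- `IsRestriction lam F h` says that `h(X) = F(X^{γ_1}, …, X^{γ_{d+g}})`: the coefficient of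
`X^w` in `h` is the sum of the coefficients of `F` at the (finitely many) exponents `α` with
`∑_i α_i γ_i = w`. -/
def IsRestriction (F : MvPowerSeries (Fin (d + g)) K) (h : QSeries K d) : Prop :=
  ∀ w : Fin d → ℚ, h.coeff w =
    ∑ᶠ (α : Fin (d + g) →₀ ℕ) (_ : ∑ i, α i • gen lam i = w), MvPowerSeries.coeff α F

/-- The ideal of the germ `(Z^Γ, 0) ⊆ (K^{d+g}, 0)`: the convergent power series
`F ∈ K{U_1, …, U_{d+g}}` with `F(X^{γ_1}, …, X^{γ_{d+g}}) = 0`. -/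
def germIdeal : Set (MvPowerSeries (Fin (d + g)) K) :=
  {F | MvConverges v F ∧ IsRestriction lam F 0}

/-- The Jacobian ideal `Jac(S_0) ⊆ O_{S_0}`: it is generated by the restrictions to `S_0` of the
minors of order `g = codim S_0` of the Jacobian matrices of elements of the ideal of `S_0`. -/
def germJacobian : Ideal (monomialGerm v lam) :=
  Ideal.span {h | ∃ F : Fin g → MvPowerSeries (Fin (d + g)) K,
    (∀ a, F a ∈ germIdeal v lam) ∧ ∃ j : Fin g ↪o Fin (d + g),
      IsRestriction lam
        (Matrix.det (Matrix.of fun a b => MvPowerSeries.pderiv K (j b) (F a))) h.val}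

/-- The logarithmic derivative `∑ c_w X^w ↦ ∑ ℓ(w) c_w X^w` along a linear form `ℓ`. -/
def logDeriv (ℓ : (Fin d → ℚ) →ₗ[ℚ] ℚ) (F : QSeries K d) : QSeries K d where
  coeff w := ((ℓ w : ℚ) : K) * F.coeff w
  isPWO_support' := F.isPWO_support.mono fun w hw h0 => hw (by simp [h0])

/-- `u` is a basis of the lattice `M`. -/
def IsLatticeBasis (u : Module.Basis (Fin d) ℚ (Fin d → ℚ)) : Prop :=
  AddSubgroup.closure (Set.range u) = topLattice lam

/-- The logarithmic Jacobian ideal `J_log(S_0) O_Z`.  With respect to the basis `u` of `M`, the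
composite `Ω^d_{S_0} → Ω^d_Z → Ω^d_Z(log D) = O_Z ⊗ ⋀^d M ≅ O_Z` sends
`df_1 ∧ ⋯ ∧ df_d` to the determinant of the logarithmic derivatives of the `f_j` along the
coordinates with respect to `u`; the forms `df_1 ∧ ⋯ ∧ df_d` generate `Ω^d_{S_0}`. -/
def germLogJacobian (u : Module.Basis (Fin d) ℚ (Fin d → ℚ)) : Ideal (normalizedGerm v lam) :=
  Ideal.span {h | ∃ f : Fin d → monomialGerm v lam,
    h.val = Matrix.det (Matrix.of fun i j => logDeriv (u.coord i) (f j).val)}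

/-- The monomial ideal `I_g ⊆ O_Z` generated by the `X^{γ_{j_1} + ⋯ + γ_{j_d}}` with
`γ_{j_1} ∧ ⋯ ∧ γ_{j_d} ≠ 0`. -/
def monomialIdeal : Ideal (normalizedGerm v lam) :=
  Ideal.span {h | ∃ j : Fin d ↪o Fin (d + g), WedgeNeZero lam j ∧
    h.val = mono K (∑ a, gen lam (j a))}

/-- The fractional ideal `X^w · I`, for an ideal `I` of `O_Z`, as a subset of the ambient ring. -/
def monoMul (w : Fin d → ℚ) (I : Ideal (normalizedGerm v lam)) : Set (QSeries K d) :=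
  {h | ∃ F ∈ I, h = mono K w * F.val}

end Germ

end QuasiOrdinary

end

/-!
The proof is elementary: neither the Abhyankar–Jung theorem nor a division theorem for convergent
power series is used.

*Characteristic exponents.* Two roots of `f` in `K{X^{1/n}}` are conjugate under
`X_i^{1/n} ↦ η_i X_i^{1/n}` with `η_i^n = 1`, because the product of `Y - z` over the distinct
conjugates `z` of one root is invariant, so lies in `K{X}[Y]`, and divides the irreducible `f`
(`exists_eq_of_isRoot_of_irreducible`). The difference of two distinct roots divides the
discriminant `X^δ · unit`, hence has a least exponent: the sets of exponents of the two factors of a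
product with a least exponent have a least element (`IsDominant.exists_of_mul`). Hence the
characteristic exponents are finite in number and, the roots being conjugate, positive and totally
ordered (`pos_of_mem_charExponents`, `isChain_charExponents`). If `f` has no root in
`K{X^{1/n}}`, there are no characteristic exponents and the results below apply with `g = 0`.

*The semigroup.* For a chain of positive vectors `λ_j`, every element of `M` is uniquely
`a + ∑ c_j λ̄_j` with `a ∈ ℤ^d` and `0 ≤ c_j < n_j`, and since `n_j λ̄_j` lies in the semigroup
generated by `ℕ^d, λ̄_1, …, λ̄_{j-1}` (`IsExponentChain.exists_isRelation`), it belongs to `Γ`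
exactly when `a ≥ 0`. The minimal Frobenius vector is the point with `a = (-1, …, -1)` and
`c_j = n_j - 1`. Writing `n_j λ̄_j = ∑ β_{j,i} γ_i` with `β_{j,i} = 0` for `i ≥ d + j` produces the
binomials `U_{d+j}^{n_j} - U^{β_j}`, which vanish on `Z^Γ`, and the triangular relation matrix `ℓ`
with rows `n_j e_{d+j} - β_j`.

*Jacobian ideals.* If `F` vanishes on `Z^Γ`, then the vector of the logarithmic derivatives
`X^{γ_i} ∂_iF(X^γ)` is a combination of the rows of `ℓ`, with the coefficient of the `j`-th row
in `X^{n_j λ̄_j}` times a series with exponents in `Γ`. Hence each minor of order `g` is a minor of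
`ℓ` times a multiple of `X^{∑ n_j λ̄_j - ∑_{i ∈ J} γ_i}`, where `J` is its set of columns, and this
exponent is `γ_0` plus the sum of the generators with index outside `J`. The minor of `ℓ` with
columns `J` is non-zero exactly when these complementary generators are linearly independent
(`det_submatrix_eq_of_log_relation`, `IsRelation.det_ne_zero_iff`). The minors of the binomials are
non-zero constants times the monomials `X^{γ_0 + γ_{j_1} + ⋯ + γ_{j_d}}`, which gives the formula of
the affine case. For the germ, the restriction `U_i ↦ X^{γ_i}` makes sense on formal power series
since the `γ_i` are positive; the same computation applies, and the convergence of the cofactors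
follows from that of the minor.

*The logarithmic Jacobian ideal.* The image of `dh_1 ∧ ⋯ ∧ dh_d` is the determinant of the
logarithmic derivatives of the `h_k`. By multilinearity its exponents lie in the union of the sets
`γ_{j_1} + ⋯ + γ_{j_d} + Γ` with `γ_{j_1} ∧ ⋯ ∧ γ_{j_d} ≠ 0`, so it belongs to `𝓘_g`
(`IsExponentChain.mem_monomialIdeal`); the choice `h_k = X^{γ_{j_k}}` gives the converse.
-/

noncomputable section

namespace QuasiOrdinary

/-! ### The lattices generated by the exponents -/

section Lattice

variable {d g : ℕ} {lam : Fin g → Fin d → ℚ}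

/-- A chain of positive exponents; strictness is not needed for the structure of `Γ`. -/
structure IsExponentChain (lam : Fin g → Fin d → ℚ) : Prop where
  monotone : Monotone lam
  pos : ∀ j, 0 < lam j

theorem mem_fracLattice_one {w : Fin d → ℚ} :
    w ∈ fracLattice d 1 ↔ ∃ a : Fin d → ℤ, w = fun i => (a i : ℚ) := by
  constructor
  · intro h
    choose a ha using h
    exact ⟨a, funext fun i => by simpa using ha i⟩
  · rintro ⟨a, rfl⟩ i
    exact ⟨a i, by simp⟩

theorem lattice_zero : lattice lam 0 = fracLattice d 1 := by
  simp [lattice]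

theorem lattice_succ {k : ℕ} (hk : k < g) :
    lattice lam (k + 1) = lattice lam k ⊔ AddSubgroup.zmultiples (lam ⟨k, hk⟩) := by
  rw [lattice, lattice, sup_assoc, AddSubgroup.zmultiples_eq_closure, ← AddSubgroup.closure_union]
  congr 2
  ext w
  simp only [Set.mem_ofPred_eq, Set.mem_union, Set.mem_singleton_iff]
  constructor
  · rintro ⟨i, hi, rfl⟩
    rcases Nat.lt_succ_iff_lt_or_eq.1 hi with h | h
    · exact Or.inl ⟨i, h, rfl⟩
    · exact Or.inr (by congr 1; exact Fin.ext h)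
  · rintro (⟨i, hi, rfl⟩ | rfl)
    · exact ⟨i, hi.trans (Nat.lt_succ_self k), rfl⟩
    · exact ⟨⟨k, hk⟩, Nat.lt_succ_self k, rfl⟩

theorem lattice_mono {k l : ℕ} (h : k ≤ l) : lattice lam k ≤ lattice lam l := by
  refine sup_le_sup_left (AddSubgroup.closure_mono ?_) _
  rintro w ⟨i, hi, rfl⟩
  exact ⟨i, hi.trans_le h, rfl⟩

theorem fracLattice_one_le_lattice (k : ℕ) : fracLattice d 1 ≤ lattice lam k := le_sup_left

theorem lamBarAux_sub_lam_mem {k : ℕ} (hk : k < g) :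
    lamBarAux lam k hk - lam ⟨k, hk⟩ ∈ lattice lam k := by
  induction k with
  | zero => simp [lamBarAux]
  | succ k ih =>
    have hk' : k < g := Nat.lt_of_succ_lt hk
    have hl : lam ⟨k, hk'⟩ ∈ lattice lam (k + 1) := by
      rw [lattice_succ hk']
      exact AddSubgroup.mem_sup_right (AddSubgroup.mem_zmultiples _)
    have hb : lamBarAux lam k hk' ∈ lattice lam (k + 1) := by
      simpa using add_mem (lattice_mono (Nat.le_succ k) (ih hk')) hl
    have : lamBarAux lam (k + 1) hk - lam ⟨k + 1, hk⟩ =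
        charIndex lam k • lamBarAux lam k hk' - lam ⟨k, hk'⟩ := by
      rw [lamBarAux]; abel
    rw [this]
    exact sub_mem (nsmul_mem hb _) hl

/-- The vectors `λ̄_1, …, λ̄_k` generate the same lattice over `ℤ^d` as `λ_1, …, λ_k`. -/
theorem lattice_succ_eq_sup_lamBarAux {k : ℕ} (hk : k < g) :
    lattice lam (k + 1) = lattice lam k ⊔ AddSubgroup.zmultiples (lamBarAux lam k hk) := by
  have h := lamBarAux_sub_lam_mem (lam := lam) hk
  rw [lattice_succ hk]
  refine le_antisymm (sup_le le_sup_left ?_) (sup_le le_sup_left ?_) <;>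
    rw [AddSubgroup.zmultiples_le]
  · have h2 : lam ⟨k, hk⟩ = -(lamBarAux lam k hk - lam ⟨k, hk⟩) + lamBarAux lam k hk := by abel
    rw [h2]
    exact AddSubgroup.add_mem_sup (neg_mem h) (AddSubgroup.mem_zmultiples _)
  · have h2 : lamBarAux lam k hk = (lamBarAux lam k hk - lam ⟨k, hk⟩) + lam ⟨k, hk⟩ := by abel
    rw [h2]
    exact AddSubgroup.add_mem_sup h (AddSubgroup.mem_zmultiples _)

theorem relIndex_sup_zmultiples {A : Type*} [AddCommGroup A] (H : AddSubgroup A) (x : A) :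
    H.relIndex (H ⊔ AddSubgroup.zmultiples x) = addOrderOf (QuotientAddGroup.mk' H x) := by
  have h := AddSubgroup.relIndex_ker (H ⊔ AddSubgroup.zmultiples x) (QuotientAddGroup.mk' H)
  rw [QuotientAddGroup.ker_mk'] at h
  rw [h, AddSubgroup.map_sup,
    (AddSubgroup.map_eq_bot_iff H).2 (QuotientAddGroup.ker_mk' H).ge, bot_sup_eq,
    AddMonoidHom.map_zmultiples, Nat.card_zmultiples]

/-- The index `n_{k+1}` is the order of `λ̄_{k+1}` modulo `M_k`. -/
theorem zsmul_lamBarAux_mem_iff {k : ℕ} (hk : k < g) (m : ℤ) :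
    m • lamBarAux lam k hk ∈ lattice lam k ↔ (charIndex lam k : ℤ) ∣ m := by
  rw [charIndex, lattice_succ_eq_sup_lamBarAux hk, relIndex_sup_zmultiples,
    addOrderOf_dvd_iff_zsmul_eq_zero, ← map_zsmul, QuotientAddGroup.mk'_apply,
    QuotientAddGroup.eq_zero_iff]

theorem exists_nsmul_mem_fracLattice (w : Fin d → ℚ) : ∃ m, 0 < m ∧ m • w ∈ fracLattice d 1 := by
  refine ⟨∏ i, (w i).den, Finset.prod_pos fun i _ => (w i).den_pos, fun i => ?_⟩
  refine ⟨(∏ j ∈ Finset.univ.erase i, ((w j).den : ℤ)) * (w i).num, ?_⟩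
  rw [← Finset.prod_erase_mul _ _ (Finset.mem_univ i)]
  simp [mul_assoc, Rat.den_mul_eq_num]

/-- The index, an infinite one being recorded as `0`, is finite because the exponents are
rational. -/
theorem charIndex_pos {k : ℕ} (hk : k < g) : 0 < charIndex lam k := by
  obtain ⟨m, hm, h⟩ := exists_nsmul_mem_fracLattice (lamBarAux lam k hk)
  have h1 : ((m : ℤ) • lamBarAux lam k hk) ∈ lattice lam k := by
    rw [natCast_zsmul]; exact fracLattice_one_le_lattice k h
  rw [zsmul_lamBarAux_mem_iff, Int.natCast_dvd_natCast] at h1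
  exact Nat.pos_of_dvd_of_pos h1 hm

theorem charIndex_nsmul_lamBar_mem (j : Fin g) :
    charIndex lam j • lamBar lam j ∈ lattice lam j := by
  rw [← natCast_zsmul, lamBar, zsmul_lamBarAux_mem_iff]

/-! ### Normal forms in the lattice -/

/-- The vector `a + ∑ c_j λ̄_j` of `M`. -/
def latticePoint (lam : Fin g → Fin d → ℚ) (a : Fin d → ℤ) (c : Fin g → ℕ) : Fin d → ℚ :=
  (fun i => (a i : ℚ)) + ∑ j, c j • lamBar lam j

theorem latticePoint_apply (a : Fin d → ℤ) (c : Fin g → ℕ) (i : Fin d) :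
    latticePoint lam a c i = a i + ∑ j, (c j : ℚ) * lamBar lam j i := by
  simp [latticePoint, Finset.sum_apply]

/-- Existence of normal forms: reduce the coefficient of the last `λ̄_j` modulo `n_j` and recurse. -/
theorem exists_latticePoint {k : ℕ} (hk : k ≤ g) {x : Fin d → ℚ} (hx : x ∈ lattice lam k) :
    ∃ a c, (∀ j : Fin g, c j < charIndex lam j) ∧ (∀ j : Fin g, k ≤ j → c j = 0) ∧
      x = latticePoint lam a c := by
  induction k generalizing x with
  | zero =>
    rw [lattice_zero, mem_fracLattice_one] at hx
    obtain ⟨a, rfl⟩ := hx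
    exact ⟨a, 0, fun j => charIndex_pos j.2, fun _ _ => rfl, by simp [latticePoint]⟩
  | succ k ih =>
    have hk' : k < g := hk
    rw [lattice_succ_eq_sup_lamBarAux hk', AddSubgroup.mem_sup] at hx
    obtain ⟨y, hy, z, hz, rfl⟩ := hx
    obtain ⟨m, rfl⟩ := AddSubgroup.mem_zmultiples_iff.1 hz
    have hn : (0 : ℤ) < charIndex lam k := by exact_mod_cast charIndex_pos hk'
    have hy' : y + ((charIndex lam k : ℤ) * (m / charIndex lam k)) • lamBarAux lam k hk' ∈
        lattice lam k :=
      add_mem hy ((zsmul_lamBarAux_mem_iff hk' _).2 (dvd_mul_right _ _))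
    obtain ⟨a, c, hc, hc0, hac⟩ := ih hk'.le hy'
    have hr0 := Int.emod_nonneg m hn.ne'
    have hr1 := Int.emod_lt_of_pos m hn
    refine ⟨a, c + Pi.single ⟨k, hk'⟩ (m % charIndex lam k).toNat, fun j => ?_, fun j hj => ?_, ?_⟩
    · by_cases h : j = ⟨k, hk'⟩
      · subst h
        have h0 : c ⟨k, hk'⟩ = 0 := hc0 ⟨k, hk'⟩ le_rfl
        simp only [Pi.add_apply, Pi.single_eq_same, h0, zero_add]
        omega
      · simpa [h] using hc j
    · have h : j ≠ ⟨k, hk'⟩ := by rintro rfl; simp at hj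
      simpa [h] using hc0 j (by omega)
    · have e1 : latticePoint lam a (c + Pi.single ⟨k, hk'⟩ (m % charIndex lam k).toNat) =
          latticePoint lam a c + (m % charIndex lam k) • lamBarAux lam k hk' := by
        simp only [latticePoint, Pi.add_apply, add_smul, Finset.sum_add_distrib, add_assoc]
        congr 2
        rw [Finset.sum_eq_single ⟨k, hk'⟩]
        · rw [Pi.single_eq_same, ← natCast_zsmul, Int.toNat_of_nonneg hr0]; rfl
        · intro b _ hb; simp [hb]
        · simp
      rw [e1, ← hac, add_assoc, ← add_smul, Int.mul_ediv_add_emod]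

/-- Uniqueness of normal forms, by descending induction on the index of the coefficient. -/
theorem latticePoint_inj {a a' : Fin d → ℤ} {c c' : Fin g → ℕ}
    (hc : ∀ j : Fin g, c j < charIndex lam j) (hc' : ∀ j : Fin g, c' j < charIndex lam j)
    (h : latticePoint lam a c = latticePoint lam a' c') : a = a' ∧ c = c' := by
  have key : ∀ (m : ℕ) (j : Fin g), g ≤ j + m → c j = c' j := by
    intro m
    induction m with
    | zero => intro j hj; omega
    | succ m ih =>
      intro j hj
      have e : ((c j : ℤ) - c' j) • lamBarAux lam j j.2 ∈ lattice lam j := by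
        have e1 : ((c j : ℤ) - c' j) • lamBarAux lam j j.2 =
            ((fun i => (a' i : ℚ)) - (fun i => (a i : ℚ))) +
              ∑ l ∈ Finset.univ.erase j, ((c' l : ℤ) - c l) • lamBar lam l := by
          have h' := h
          simp only [latticePoint] at h'
          rw [← Finset.add_sum_erase _ _ (Finset.mem_univ j),
            ← Finset.add_sum_erase _ (fun j => c' j • lamBar lam j) (Finset.mem_univ j)] at h'
          simp only [sub_smul, natCast_zsmul, Finset.sum_sub_distrib]
          change c j • lamBar lam j - c' j • lamBar lam j = _
          rw [← sub_eq_zero] at h' ⊢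
          rw [← h']; abel
        rw [e1]
        refine add_mem (sub_mem ?_ ?_) (sum_mem fun l hl => ?_)
        · exact fracLattice_one_le_lattice _ (mem_fracLattice_one.2 ⟨_, rfl⟩)
        · exact fracLattice_one_le_lattice _ (mem_fracLattice_one.2 ⟨_, rfl⟩)
        · rcases lt_or_ge l j with hlj | hlj
          · refine zsmul_mem (lattice_mono (k := l + 1) hlj ?_) _
            rw [lattice_succ_eq_sup_lamBarAux l.2]
            exact AddSubgroup.mem_sup_right (AddSubgroup.mem_zmultiples _)
          · have hne : l ≠ j := Finset.ne_of_mem_erase hl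
            have : c l = c' l := ih l (by
              have : j < l := lt_of_le_of_ne hlj hne.symm
              omega)
            rw [this, sub_self, zero_smul]
            exact zero_mem _
      rw [zsmul_lamBarAux_mem_iff] at e
      have h1 := hc j
      have h2 := hc' j
      have := Int.eq_zero_of_abs_lt_dvd e (by rw [abs_lt]; omega)
      omega
  have hcc : c = c' := funext fun j => key g j (Nat.le_add_left _ _)
  subst hcc
  refine ⟨funext fun i => ?_, rfl⟩
  have := congrFun h i
  simpa [latticePoint_apply] using this

/-! ### Positivity -/

theorem IsExponentChain.lam_le_lamBarAux (h : IsExponentChain lam) {k : ℕ} (hk : k < g) :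
    lam ⟨k, hk⟩ ≤ lamBarAux lam k hk := by
  induction k with
  | zero => exact le_rfl
  | succ k ih =>
    have hk' : k < g := Nat.lt_of_succ_lt hk
    have h1 : lam ⟨k, hk'⟩ ≤ charIndex lam k • lamBarAux lam k hk' :=
      (ih hk').trans (le_self_nsmul ((h.pos _).le.trans (ih hk')) (charIndex_pos hk').ne')
    rw [lamBarAux, add_sub_assoc, add_sub, le_sub_iff_add_le, add_comm]
    exact add_le_add_left h1 _

theorem IsExponentChain.lamBar_pos (h : IsExponentChain lam) (j : Fin g) : 0 < lamBar lam j :=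
  (h.pos j).trans_le (h.lam_le_lamBarAux j.2)

theorem IsExponentChain.nsmul_lamBarAux_le (h : IsExponentChain lam) {k : ℕ} (hk : k + 1 < g) :
    charIndex lam k • lamBarAux lam k (Nat.lt_of_succ_lt hk) ≤ lamBarAux lam (k + 1) hk := by
  rw [lamBarAux, add_sub_assoc]
  have : lam ⟨k, Nat.lt_of_succ_lt hk⟩ ≤ lam ⟨k + 1, hk⟩ := h.monotone (by simp [Fin.le_def])
  exact le_add_of_nonneg_right (sub_nonneg.2 this)

/-- A reduced combination of the `λ̄_j` with `j ≤ k` is at most `λ̄_{k+1}`, because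
`n_j λ̄_j ≤ λ̄_{j+1}`. -/
theorem IsExponentChain.sum_le_lamBarAux (h : IsExponentChain lam) {k : ℕ} (hk : k < g)
    (c : Fin g → ℕ) (hc : ∀ j : Fin g, c j < charIndex lam j) (hc0 : ∀ j : Fin g, k ≤ j → c j = 0) :
    ∑ j, c j • lamBar lam j ≤ lamBarAux lam k hk := by
  induction k generalizing c with
  | zero =>
    rw [Finset.sum_eq_zero fun j _ => by rw [hc0 j (Nat.zero_le _), zero_smul]]
    exact (h.lamBar_pos ⟨0, hk⟩).le
  | succ k ih =>
    have hk' : k < g := Nat.lt_of_succ_lt hk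
    have hi := ih hk' (Function.update c ⟨k, hk'⟩ 0) (fun j => ?_) (fun j hj => ?_)
    · have e : ∑ j, c j • lamBar lam j =
          ∑ j, (Function.update c ⟨k, hk'⟩ 0) j • lamBar lam j +
            c ⟨k, hk'⟩ • lamBarAux lam k hk' := by
        rw [← Finset.sum_erase_add _ _ (Finset.mem_univ (⟨k, hk'⟩ : Fin g)),
          ← Finset.sum_erase_add _ _ (Finset.mem_univ (⟨k, hk'⟩ : Fin g))]
        simp only [Function.update_self, zero_smul, add_zero]
        congr 1
        refine Finset.sum_congr rfl fun j hj => ?_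
        rw [Function.update_of_ne (Finset.ne_of_mem_erase hj)]
      rw [e]
      refine le_trans ?_ (h.nsmul_lamBarAux_le hk)
      obtain ⟨m, hm⟩ : ∃ m, charIndex lam k = m + 1 :=
        ⟨charIndex lam k - 1, by have := charIndex_pos (lam := lam) hk'; omega⟩
      have hcm : c ⟨k, hk'⟩ ≤ m := by have := hc ⟨k, hk'⟩; simp only at this; omega
      rw [hm, succ_nsmul, add_comm]
      exact add_le_add (nsmul_le_nsmul_left (h.lamBar_pos ⟨k, hk'⟩).le hcm) hi
    · by_cases hj : j = ⟨k, hk'⟩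
      · subst hj; simpa using charIndex_pos hk'
      · rw [Function.update_of_ne hj]; exact hc j
    · by_cases hj' : j = ⟨k, hk'⟩
      · subst hj'; simp
      · rw [Function.update_of_ne hj']
        refine hc0 j ?_
        have : (j : ℕ) ≠ k := fun h => hj' (Fin.ext h)
        omega

/-! ### Weights and the relations between the generators -/

/-- The weight `∑ α_i γ_i` of an exponent `α`, so that `U^α` restricts to `X^{weight α}`. -/
def weight (lam : Fin g → Fin d → ℚ) : (Fin (d + g) →₀ ℕ) →+ (Fin d → ℚ) where
  toFun α := ∑ i, α i • gen lam i
  map_zero' := by simp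
  map_add' := by intro α β; simp [add_smul, Finset.sum_add_distrib]

theorem weight_apply (α : Fin (d + g) →₀ ℕ) : weight lam α = ∑ i, α i • gen lam i := rfl

@[simp] theorem weight_single (i : Fin (d + g)) (m : ℕ) :
    weight lam (Finsupp.single i m) = m • gen lam i := by
  rw [weight_apply, Finset.sum_eq_single i]
  · simp
  · intro b _ hb; simp [hb.symm]
  · simp

theorem mem_semigroup_iff {w : Fin d → ℚ} : w ∈ semigroup lam ↔ ∃ α, weight lam α = w := by
  rw [semigroup, AddSubmonoid.mem_closure_range_iff_of_fintype,
    Finsupp.equivFunOnFinite.symm.exists_congr_left]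
  simp [weight_apply, eq_comm]

theorem weight_mem_semigroup (α : Fin (d + g) →₀ ℕ) : weight lam α ∈ semigroup lam :=
  mem_semigroup_iff.2 ⟨α, rfl⟩

theorem weight_eq_latticePoint (α : Fin (d + g) →₀ ℕ) :
    weight lam α = latticePoint lam (fun i => α (Fin.castAdd g i)) (fun j => α (Fin.natAdd d j)) := by
  rw [weight_apply, Fin.sum_univ_add, latticePoint]
  congr 1
  · ext i
    simp [gen, Finset.sum_apply, Pi.single_apply]
  · simp [gen]

/-- The exponent with `Fin d`-part `a` and `Fin g`-part `c`. -/
def exponent (a : Fin d → ℕ) (c : Fin g → ℕ) : Fin (d + g) →₀ ℕ :=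
  Finsupp.equivFunOnFinite.symm (Fin.append a c)

@[simp] theorem exponent_castAdd (a : Fin d → ℕ) (c : Fin g → ℕ) (i : Fin d) :
    exponent a c (Fin.castAdd g i) = a i := by simp [exponent]

@[simp] theorem exponent_natAdd (a : Fin d → ℕ) (c : Fin g → ℕ) (j : Fin g) :
    exponent a c (Fin.natAdd d j) = c j := by simp [exponent]

theorem latticePoint_mem_semigroup {a : Fin d → ℤ} (ha : 0 ≤ a) (c : Fin g → ℕ) :
    latticePoint lam a c ∈ semigroup lam := by
  refine mem_semigroup_iff.2 ⟨exponent (fun i => (a i).toNat) c, ?_⟩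
  rw [weight_eq_latticePoint]
  congr 1
  · funext i; simpa using ha i
  · funext j; simp

theorem IsExponentChain.gen_pos (h : IsExponentChain lam) (i : Fin (d + g)) : 0 < gen lam i := by
  refine Fin.addCases (fun i => ?_) (fun j => ?_) i
  · rw [gen, Fin.append_left]
    exact Pi.single_pos.2 one_pos
  · rw [gen, Fin.append_right]
    exact h.lamBar_pos j

theorem IsExponentChain.weight_nonneg (h : IsExponentChain lam) (α : Fin (d + g) →₀ ℕ) :
    0 ≤ weight lam α :=
  Finset.sum_nonneg fun i _ => nsmul_nonneg (h.gen_pos i).le _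

theorem IsExponentChain.nonneg_of_mem_semigroup (h : IsExponentChain lam) {w : Fin d → ℚ}
    (hw : w ∈ semigroup lam) : 0 ≤ w := by
  obtain ⟨α, rfl⟩ := mem_semigroup_iff.1 hw
  exact h.weight_nonneg α

/-- `β j` is the exponent of a monomial in the variables preceding `U_{d+j}` which agrees with
`U_{d+j}^{n_j}` on `Z^Γ`. -/
def IsRelation (lam : Fin g → Fin d → ℚ) (β : Fin g → Fin (d + g) →₀ ℕ) : Prop :=
  ∀ j, weight lam (β j) = charIndex lam j • lamBar lam j ∧ ∀ k, j ≤ k → β j (Fin.natAdd d k) = 0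

/-- The integral part of the normal form of `n_j λ̄_j` is non-negative: the rest of the normal form
is bounded by `λ̄_j`. -/
theorem IsExponentChain.exists_isRelation (h : IsExponentChain lam) : ∃ β, IsRelation lam β := by
  have : ∀ j : Fin g, ∃ β : Fin (d + g) →₀ ℕ,
      weight lam β = charIndex lam j • lamBar lam j ∧ ∀ k, j ≤ k → β (Fin.natAdd d k) = 0 := by
    intro j
    obtain ⟨a, c, hc, hc0, hac⟩ :=
      exists_latticePoint j.2.le (charIndex_nsmul_lamBar_mem (lam := lam) j)
    have ha : 0 ≤ a := by
      intro i
      have h1 := h.sum_le_lamBarAux j.2 c hc hc0 i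
      have h2 := congrFun hac i
      rw [latticePoint_apply] at h2
      have h3 : lamBar lam j ≤ charIndex lam j • lamBar lam j :=
        le_self_nsmul (h.lamBar_pos j).le (charIndex_pos j.2).ne'
      have h4 := h3 i
      have h5 : (∑ j, c j • lamBar lam j) i = ∑ j, (c j : ℚ) * lamBar lam j i := by
        simp [Finset.sum_apply]
      rw [h5] at h1
      rw [h2] at h4
      have h6 : (0 : ℚ) ≤ a i := by
        change _ ≤ lamBar lam j i at h1
        linarith
      exact_mod_cast h6
    refine ⟨exponent (fun i => (a i).toNat) c, ?_, fun k hk => by simpa using hc0 k hk⟩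
    rw [hac, weight_eq_latticePoint]
    congr 1
    · funext i; simpa using ha i
    · funext j; simp
  choose β hβ using this
  exact ⟨β, hβ⟩

/-- The vector `n_j e_{d+j} - β_j` of the relation `U_{d+j}^{n_j} = U^{β_j}`. -/
def relVec (lam : Fin g → Fin d → ℚ) (β : Fin g → Fin (d + g) →₀ ℕ) :
    Matrix (Fin g) (Fin (d + g)) ℤ :=
  Matrix.of fun j i => (if i = Fin.natAdd d j then (charIndex lam j : ℤ) else 0) - β j i

/-- Exponents `α` with `α_{d+j} < n_j` for all `j`; they form a set of representatives of the fibres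
of the weight. -/
def IsReduced (lam : Fin g → Fin d → ℚ) (α : Fin (d + g) →₀ ℕ) : Prop :=
  ∀ j : Fin g, α (Fin.natAdd d j) < charIndex lam j

theorem IsReduced.eq_of_weight_eq {α α' : Fin (d + g) →₀ ℕ} (h : IsReduced lam α)
    (h' : IsReduced lam α') (hw : weight lam α = weight lam α') : α = α' := by
  rw [weight_eq_latticePoint, weight_eq_latticePoint] at hw
  obtain ⟨h1, h2⟩ := latticePoint_inj h h' hw
  ext i
  refine Fin.addCases (fun i => ?_) (fun j => ?_) i
  · exact_mod_cast congrFun h1 i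
  · exact congrFun h2 j

/-- Rewriting an exponent with the relations: the relation `ℓ_j` is used `m_j` times, and only if
`weight α - n_j λ̄_j ∈ Γ`. -/
theorem IsRelation.exists_reduced {β : Fin g → Fin (d + g) →₀ ℕ} (hβ : IsRelation lam β)
    (α : Fin (d + g) →₀ ℕ) :
    ∃ (α' : Fin (d + g) →₀ ℕ) (m : Fin g → ℕ), IsReduced lam α' ∧ weight lam α' = weight lam α ∧
      (∀ i, (α i : ℤ) = α' i + ∑ j, (m j : ℤ) * relVec lam β j i) ∧
      ∀ j, m j ≠ 0 → ∃ s ∈ semigroup lam, weight lam α = charIndex lam j • lamBar lam j + s := by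
  -- induction on `k`, where only the variables `U_{d+1}, …, U_{d+k}` may have too large an exponent;
  -- reducing the last of them leaves the later exponents unchanged
  suffices H : ∀ k ≤ g, ∀ α : Fin (d + g) →₀ ℕ,
      (∀ j : Fin g, k ≤ j → α (Fin.natAdd d j) < charIndex lam j) →
      ∃ (α' : Fin (d + g) →₀ ℕ) (m : Fin g → ℕ), IsReduced lam α' ∧
        weight lam α' = weight lam α ∧
        (∀ i, (α i : ℤ) = α' i + ∑ j, (m j : ℤ) * relVec lam β j i) ∧
        ∀ j, m j ≠ 0 → ∃ s ∈ semigroup lam,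
          weight lam α = charIndex lam j • lamBar lam j + s from
    H g le_rfl α fun j hj => absurd j.2 (not_lt.2 hj)
  intro k
  induction k with
  | zero =>
    intro _ α hα
    exact ⟨α, 0, fun j => hα j (Nat.zero_le _), rfl, by simp, by simp⟩
  | succ k ih =>
    intro hk α hα
    have hk' : k < g := hk
    set j : Fin g := ⟨k, hk'⟩ with hj
    set n := charIndex lam k with hn
    have hn0 : 0 < n := charIndex_pos hk'
    set q := α (Fin.natAdd d j) / n with hq
    have hle : Finsupp.single (Fin.natAdd d j) (n * q) ≤ α := by
      rw [Finsupp.single_le_iff]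
      exact Nat.mul_div_le _ _
    obtain ⟨ρ, hρ⟩ := exists_add_of_le hle
    have hρw : weight lam α = (n * q) • lamBar lam j + weight lam ρ := by
      conv_lhs => rw [hρ]
      rw [map_add, weight_single]; simp [gen]
    have hρj : ρ (Fin.natAdd d j) = α (Fin.natAdd d j) % n := by
      have e := DFunLike.congr_fun hρ (Fin.natAdd d j)
      simp only [Finsupp.add_apply, Finsupp.single_eq_same] at e
      have := Nat.div_add_mod (α (Fin.natAdd d j)) n
      rw [← hq] at this
      omega
    have hρi : ∀ i, i ≠ Fin.natAdd d j → ρ i = α i := by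
      intro i hi
      have e := DFunLike.congr_fun hρ i
      simpa [Finsupp.single_apply, hi.symm] using e.symm
    have hw' : weight lam (ρ + q • β j) = weight lam α := by
      rw [map_add, map_nsmul, (hβ j).1, hρw, smul_smul, add_comm, mul_comm]
    obtain ⟨α', m, h1, h2, h3, h4⟩ := ih hk'.le (ρ + q • β j) (fun l hl => by
      have hz := (hβ j).2 l (Fin.le_def.2 hl)
      simp only [Finsupp.add_apply, Finsupp.smul_apply, hz, smul_zero, add_zero]
      by_cases hlj : l = j
      · subst hlj; rw [hρj]; exact Nat.mod_lt _ hn0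
      · rw [hρi _ (by simpa using hlj)]
        refine hα l ?_
        have : (l : ℕ) ≠ k := fun h => hlj (Fin.ext h)
        omega)
    refine ⟨α', m + Pi.single j q, h1, h2.trans hw', fun i => ?_, fun l hl => ?_⟩
    · have h3i := h3 i
      have e := DFunLike.congr_fun hρ i
      simp only [Finsupp.add_apply, Finsupp.smul_apply, smul_eq_mul] at e h3i
      have es : ∑ l, (((m + Pi.single j q : Fin g → ℕ) l : ℕ) : ℤ) * relVec lam β l i =
          ∑ l, (m l : ℤ) * relVec lam β l i + q * relVec lam β j i := by
        simp only [Pi.add_apply, Nat.cast_add, add_mul, Finset.sum_add_distrib]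
        congr 1
        rw [Finset.sum_eq_single j]
        · simp
        · intro b _ hb; simp [hb]
        · simp
      rw [es]
      have er : relVec lam β j i = (Finsupp.single (Fin.natAdd d j) n i : ℤ) - β j i := by
        simp [relVec, Finsupp.single_apply, eq_comm, hn, hj]
      have eq' : (Finsupp.single (Fin.natAdd d j) (n * q) i : ℤ) =
          q * (Finsupp.single (Fin.natAdd d j) n i : ℤ) := by
        simp only [Finsupp.single_apply]; split_ifs <;> simp [mul_comm]
      rw [er]
      have e' : (α i : ℤ) = (Finsupp.single (Fin.natAdd d j) (n * q) i : ℤ) + ρ i := by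
        exact_mod_cast e
      rw [e', eq']
      push_cast at h3i
      linarith
    · by_cases hlj : l = j
      · subst hlj
        by_cases hm : m j = 0
        · have hq0 : q ≠ 0 := by simpa [hm] using hl
          obtain ⟨p, hp⟩ := Nat.exists_eq_succ_of_ne_zero hq0
          refine ⟨(n * p) • lamBar lam j + weight lam ρ, add_mem (nsmul_mem ?_ _)
            (weight_mem_semigroup ρ), ?_⟩
          · have := gen_mem_semigroup lam (Fin.natAdd d j)
            simpa [gen] using this
          · rw [hρw, hp, ← add_assoc, ← add_smul]
            congr 2
            simp [hn, hj, Nat.mul_succ, add_comm]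
        · simpa [hw'] using h4 j hm
      · simpa [hw'] using h4 l (by simpa [hlj] using hl)

/-! ### The Frobenius vector -/

theorem gammaZero_apply (i : Fin d) :
    gammaZero lam i = ∑ j : Fin g, ((charIndex lam j : ℚ) - 1) * lamBar lam j i - 1 := by
  simp [gammaZero, Finset.sum_apply, Pi.single_apply]

theorem gammaZero_eq_latticePoint :
    gammaZero lam = latticePoint lam (fun _ => -1) (fun j => charIndex lam j - 1) := by
  ext i
  rw [gammaZero_apply, latticePoint_apply, sub_eq_add_neg, add_comm]
  congr 1
  refine Finset.sum_congr rfl fun j _ => ?_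
  rw [Nat.cast_sub (charIndex_pos j.2), Nat.cast_one]

theorem latticePoint_mem_topLattice (a : Fin d → ℤ) (c : Fin g → ℕ) :
    latticePoint lam a c ∈ topLattice lam :=
  add_mem (fracLattice_one_le_lattice _ (mem_fracLattice_one.2 ⟨a, rfl⟩))
    (sum_mem fun j _ => nsmul_mem (lamBarAux_mem_topLattice lam j j.2) _)

theorem IsExponentChain.isFrobeniusVector_gammaZero (h : IsExponentChain lam) :
    IsFrobeniusVector lam (gammaZero lam) := by
  have h0 : gammaZero lam ∈ topLattice lam := by
    rw [gammaZero_eq_latticePoint]; exact latticePoint_mem_topLattice _ _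
  refine ⟨h0, fun b hb hb0 => ?_⟩
  obtain ⟨a, c, hc, -, hac⟩ := exists_latticePoint le_rfl (add_mem h0 hb)
  rw [hac]
  refine latticePoint_mem_semigroup (fun i => ?_) c
  have h1 := congrFun hac i
  rw [Pi.add_apply, gammaZero_apply, latticePoint_apply] at h1
  have h2 : ∑ j, (c j : ℚ) * lamBar lam j i ≤
      ∑ j : Fin g, ((charIndex lam j : ℚ) - 1) * lamBar lam j i := by
    refine Finset.sum_le_sum fun j _ => mul_le_mul_of_nonneg_right ?_ ((h.lamBar_pos j).le i)
    have := hc j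
    rw [le_sub_iff_add_le]
    exact_mod_cast this
  have h3 := hb0 i
  have h4 : (-1 : ℚ) < a i := by linarith
  have h5 : (-1 : ℤ) < a i := by exact_mod_cast h4
  simp only [Pi.zero_apply]
  omega

/-- Rewriting an element of `Γ` into normal form keeps its coefficients non-negative. -/
theorem IsExponentChain.nonneg_of_latticePoint_mem (h : IsExponentChain lam) {a : Fin d → ℤ}
    {c : Fin g → ℕ} (hc : ∀ j : Fin g, c j < charIndex lam j)
    (hm : latticePoint lam a c ∈ semigroup lam) : 0 ≤ a := by
  obtain ⟨β, hβ⟩ := h.exists_isRelation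
  obtain ⟨α, hα⟩ := mem_semigroup_iff.1 hm
  obtain ⟨α', -, h1, h2, -, -⟩ := hβ.exists_reduced α
  rw [← h2, weight_eq_latticePoint] at hα
  obtain ⟨h3, -⟩ := latticePoint_inj h1 hc hα
  rw [← h3]
  intro i
  exact Int.natCast_nonneg _

theorem IsExponentChain.isMinimalFrobeniusVector_gammaZero (h : IsExponentChain lam) :
    IsMinimalFrobeniusVector lam (gammaZero lam) := by
  refine ⟨h.isFrobeniusVector_gammaZero, fun a' ha' i => ?_⟩
  obtain ⟨ha'M, ha'⟩ := ha'
  obtain ⟨b, k, hk, -, rfl⟩ := exists_latticePoint le_rfl ha'M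
  -- `s` is the defect `∑ (n_j - 1 - k_j) λ̄_j`; the integral vector `c` is the smallest one with
  -- `c + s > 0`, so that adding `c + s` to the given vector makes all `λ̄_j`-coefficients maximal.
  set s : Fin d → ℚ := fun i => ∑ j : Fin g, ((charIndex lam j : ℚ) - 1 - k j) * lamBar lam j i
    with hs
  set c : Fin d → ℤ := fun i => ⌊-s i⌋ + 1 with hc
  have e : latticePoint lam b k + (fun i => (c i : ℚ) + s i) =
      latticePoint lam (b + c) (fun j => charIndex lam j - 1) := by
    ext i
    simp only [Pi.add_apply, latticePoint_apply, hs]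
    have : ∑ j : Fin g, (((charIndex lam j - 1 : ℕ) : ℚ)) * lamBar lam j i =
        ∑ j, (k j : ℚ) * lamBar lam j i +
          ∑ j : Fin g, ((charIndex lam j : ℚ) - 1 - k j) * lamBar lam j i := by
      rw [← Finset.sum_add_distrib]
      refine Finset.sum_congr rfl fun j _ => ?_
      rw [Nat.cast_sub (charIndex_pos j.2)]
      push_cast; ring
    rw [this]; push_cast; ring
  have hmem : (fun i => (c i : ℚ) + s i) ∈ topLattice lam := by
    have : (fun i => (c i : ℚ) + s i) =
        latticePoint lam (b + c) (fun j => charIndex lam j - 1) - latticePoint lam b k := by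
      rw [← e]; abel
    rw [this]
    exact sub_mem (latticePoint_mem_topLattice _ _) (latticePoint_mem_topLattice _ _)
  have h1 := ha' _ hmem (fun i => by
    have := Int.lt_floor_add_one (-s i)
    simp only [hc]; push_cast; linarith)
  rw [e] at h1
  have h2 := h.nonneg_of_latticePoint_mem
    (fun j => Nat.sub_lt (charIndex_pos j.2) one_pos) h1 i
  rw [gammaZero_apply, latticePoint_apply]
  have h3 := Int.floor_le (-s i)
  have h4 : (0 : ℚ) ≤ b i + c i := by exact_mod_cast h2
  have h5 : s i = ∑ j : Fin g, ((charIndex lam j : ℚ) - 1) * lamBar lam j i -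
      ∑ j, (k j : ℚ) * lamBar lam j i := by
    rw [hs, ← Finset.sum_sub_distrib]
    exact Finset.sum_congr rfl fun j _ => by ring
  simp only [hc] at h4
  push_cast at h4
  linarith

end Lattice

/-! ### Minors of the relation matrix -/

section Minors

variable {d g : ℕ} {lam : Fin g → Fin d → ℚ} {β : Fin g → Fin (d + g) →₀ ℕ}

theorem wedgeNeZero_iff_linearIndependent {j : Fin d ↪o Fin (d + g)} :
    WedgeNeZero lam j ↔ LinearIndependent ℚ fun a => gen lam (j a) := by
  constructor
  · intro h
    by_contra hli
    exact h ((exteriorPower.ιMulti ℚ d).map_linearDependent _ hli)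
  · intro hli h
    have hb : (Pi.basisFun ℚ (Fin d)).det (fun a => gen lam (j a)) ≠ 0 := by
      rw [← isUnit_iff_ne_zero, ← Module.Basis.is_basis_iff_det]
      exact ⟨hli, hli.span_eq_top_of_card_eq_finrank' (by simp)⟩
    rw [← exteriorPower.alternatingMapLinearEquiv_apply_ιMulti, h, map_zero] at hb
    exact hb rfl

/-- `J` and `J'` enumerate complementary sets of indices. -/
def IsComplementary (J : Fin g ↪o Fin (d + g)) (J' : Fin d ↪o Fin (d + g)) : Prop :=
  Function.Bijective (Sum.elim J J')

theorem isComplementary_of_disjoint {J : Fin g ↪o Fin (d + g)} {J' : Fin d ↪o Fin (d + g)}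
    (h : ∀ a b, J a ≠ J' b) : IsComplementary J J' := by
  rw [IsComplementary, Fintype.bijective_iff_injective_and_card]
  refine ⟨Function.Injective.sumElim J.injective J'.injective h, ?_⟩
  simp [add_comm]

theorem exists_orderEmb_disjoint {m m' : ℕ} (hm : d + g = m + m') (J : Fin m ↪o Fin (d + g)) :
    ∃ J' : Fin m' ↪o Fin (d + g), ∀ a b, J a ≠ J' b := by
  classical
  have hc : ((Finset.univ.map J.toEmbedding)ᶜ).card = m' := by
    rw [Finset.card_compl]; simp; omega
  refine ⟨Finset.orderEmbOfFin _ hc, fun a b hab => ?_⟩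
  have h1 := Finset.orderEmbOfFin_mem _ hc b
  rw [← hab, Finset.mem_compl] at h1
  exact h1 (by simp)

theorem exists_isComplementary (J : Fin g ↪o Fin (d + g)) :
    ∃ J' : Fin d ↪o Fin (d + g), IsComplementary J J' := by
  obtain ⟨J', h⟩ := exists_orderEmb_disjoint (add_comm d g) J
  exact ⟨J', isComplementary_of_disjoint h⟩

theorem exists_isComplementary' (J' : Fin d ↪o Fin (d + g)) :
    ∃ J : Fin g ↪o Fin (d + g), IsComplementary J J' := by
  obtain ⟨J, h⟩ := exists_orderEmb_disjoint rfl J'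
  exact ⟨J, isComplementary_of_disjoint fun a b => (h b a).symm⟩

theorem IsComplementary.sum_eq {J : Fin g ↪o Fin (d + g)} {J' : Fin d ↪o Fin (d + g)}
    (h : IsComplementary J J') {M : Type*} [AddCommMonoid M] (x : Fin (d + g) → M) :
    ∑ i, x i = ∑ a, x (J a) + ∑ b, x (J' b) := by
  rw [← (Equiv.ofBijective _ h).sum_comp, Fintype.sum_sum_type]
  rfl

/-- The exponent arithmetic behind the factor `X^{γ_0}`. -/
theorem IsComplementary.gammaZero_add {J : Fin g ↪o Fin (d + g)} {J' : Fin d ↪o Fin (d + g)}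
    (h : IsComplementary J J') :
    gammaZero lam + ∑ b, gen lam (J' b) + ∑ a, gen lam (J a) =
      ∑ j : Fin g, charIndex lam j • lamBar lam j := by
  rw [add_assoc, add_comm (∑ b, gen lam (J' b)), ← h.sum_eq, Fin.sum_univ_add, gammaZero]
  simp only [gen, Fin.append_left, Fin.append_right, sub_smul, one_smul, Finset.sum_sub_distrib,
    Nat.cast_smul_eq_nsmul]
  abel

theorem IsRelation.relVec_natAdd_eq_zero (hβ : IsRelation lam β) {j k : Fin g} (h : j < k) :
    relVec lam β j (Fin.natAdd d k) = 0 := by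
  have : k ≠ j := h.ne'
  simp [relVec, this, (hβ j).2 k h.le]

theorem IsRelation.relVec_natAdd_self (hβ : IsRelation lam β) (j : Fin g) :
    relVec lam β j (Fin.natAdd d j) = charIndex lam j := by
  simp [relVec, (hβ j).2 j le_rfl]

/-- The relation matrix with rational entries. -/
abbrev relMatrix (lam : Fin g → Fin d → ℚ) (β : Fin g → Fin (d + g) →₀ ℕ) :
    Matrix (Fin g) (Fin (d + g)) ℚ := (relVec lam β).map (Int.cast : ℤ → ℚ)

/-- The last `g` columns form a triangular matrix with diagonal `n_1, …, n_g`. -/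
theorem IsRelation.det_last_ne_zero (hβ : IsRelation lam β) :
    ((relMatrix lam β).submatrix id (Fin.natAdd d)).det ≠ 0 := by
  rw [Matrix.det_of_isLowerTriangular _ (fun j k hjk => ?_)]
  · rw [Finset.prod_ne_zero_iff]
    intro j _
    have := charIndex_pos (lam := lam) j.2
    simp [hβ.relVec_natAdd_self]
    omega
  · have : j < k := hjk
    simp [hβ.relVec_natAdd_eq_zero this]

theorem IsRelation.sum_relVec_smul_gen (hβ : IsRelation lam β) (j : Fin g) :
    ∑ i, relMatrix lam β j i • gen lam i = 0 := by
  have h := (hβ j).1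
  rw [weight_apply] at h
  simp only [Matrix.map_apply, relVec, Matrix.of_apply, Int.cast_sub, sub_smul,
    Finset.sum_sub_distrib]
  rw [sub_eq_zero]
  have e : ∑ i, ((β j i : ℤ) : ℚ) • gen lam i = ∑ i, β j i • gen lam i :=
    Finset.sum_congr rfl fun i _ => by rw [Int.cast_natCast, Nat.cast_smul_eq_nsmul]
  rw [e, h, Finset.sum_eq_single (Fin.natAdd d j)]
  · simp [gen, Nat.cast_smul_eq_nsmul]
  · intro b _ hb; simp [hb]
  · simp

theorem IsRelation.sum_vecMul_smul_gen (hβ : IsRelation lam β) (x : Fin g → ℚ) :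
    ∑ i, (Matrix.vecMul x (relMatrix lam β)) i • gen lam i = 0 := by
  simp only [Matrix.vecMul, dotProduct, Finset.sum_smul]
  rw [Finset.sum_comm]
  refine Finset.sum_eq_zero fun j _ => ?_
  simp only [mul_smul]
  rw [← Finset.smul_sum, hβ.sum_relVec_smul_gen, smul_zero]

/-- The rows of the relation matrix span all linear relations between the `γ_i`. -/
theorem IsRelation.exists_vecMul_eq (hβ : IsRelation lam β) {z : Fin (d + g) → ℚ}
    (hz : ∑ i, z i • gen lam i = 0) : ∃ x, Matrix.vecMul x (relMatrix lam β) = z := by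
  set T := (relMatrix lam β).submatrix id (Fin.natAdd d) with hT
  have hu : IsUnit T.det := hβ.det_last_ne_zero.isUnit
  set x := Matrix.vecMul (fun j => z (Fin.natAdd d j)) T⁻¹
  have hx : Matrix.vecMul x T = fun j => z (Fin.natAdd d j) := by
    rw [Matrix.vecMul_vecMul, Matrix.nonsing_inv_mul _ hu, Matrix.vecMul_one]
  have hxj : ∀ j, Matrix.vecMul x (relMatrix lam β) (Fin.natAdd d j) = z (Fin.natAdd d j) :=
    fun j => congrFun hx j
  refine ⟨x, ?_⟩
  have h0 : ∑ i, (z i - Matrix.vecMul x (relMatrix lam β) i) • gen lam i = 0 := by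
    simp only [sub_smul, Finset.sum_sub_distrib]
    rw [hz, hβ.sum_vecMul_smul_gen, sub_zero]
  rw [Fin.sum_univ_add] at h0
  simp only [hxj, sub_self, zero_smul, Finset.sum_const_zero, add_zero, gen, Fin.append_left] at h0
  ext i
  refine Fin.addCases (fun i => ?_) hxj i
  have := congrFun h0 i
  simp [Finset.sum_apply, Pi.single_apply] at this
  linarith

/-- Since the rows form a basis of the relations between the `γ_i`, a maximal minor vanishes exactly
when there is a non-trivial relation supported on the complementary indices. -/
theorem IsRelation.det_ne_zero_iff (hβ : IsRelation lam β) {J : Fin g ↪o Fin (d + g)}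
    {J' : Fin d ↪o Fin (d + g)} (h : IsComplementary J J') :
    ((relVec lam β).submatrix id J).det ≠ 0 ↔ WedgeNeZero lam J' := by
  have hcast : ((relVec lam β).submatrix id J).det ≠ 0 ↔
      ((relMatrix lam β).submatrix id J).det ≠ 0 := by
    rw [relMatrix, Matrix.submatrix_map]
    have := (Int.castRingHom ℚ).map_det ((relVec lam β).submatrix id J)
    simp only [RingHom.mapMatrix_apply, eq_intCast, Int.coe_castRingHom] at this
    rw [← this]
    simp
  rw [hcast, wedgeNeZero_iff_linearIndependent, Fintype.linearIndependent_iff]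
  constructor
  · intro hdet y hy
    set z : Fin (d + g) → ℚ := fun i =>
      Sum.elim (fun _ => 0) y ((Equiv.ofBijective _ h).symm i) with hzdef
    have hzJ : ∀ a, z (J a) = 0 := fun a => by
      have : (Equiv.ofBijective _ h).symm (J a) = Sum.inl a := by
        rw [Equiv.symm_apply_eq]; rfl
      simp [hzdef, this]
    have hzJ' : ∀ a, z (J' a) = y a := fun a => by
      have : (Equiv.ofBijective _ h).symm (J' a) = Sum.inr a := by
        rw [Equiv.symm_apply_eq]; rfl
      simp [hzdef, this]
    obtain ⟨x, hx⟩ := hβ.exists_vecMul_eq (z := z) (by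
      rw [h.sum_eq]; simpa [hzJ, hzJ'] using hy)
    have hx0 : x = 0 := by
      by_contra hne
      refine hdet (Matrix.exists_vecMul_eq_zero_iff.1 ⟨x, hne, ?_⟩)
      ext a
      have := congrFun hx (J a)
      rw [hzJ] at this
      exact this
    intro a
    rw [← hzJ', ← hx, hx0, Matrix.zero_vecMul]
    rfl
  · intro hli hdet
    obtain ⟨x, hne, hx⟩ := Matrix.exists_vecMul_eq_zero_iff.2 hdet
    have hxJ : ∀ a, Matrix.vecMul x (relMatrix lam β) (J a) = 0 := fun a => congrFun hx a
    have h0 := hβ.sum_vecMul_smul_gen x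
    rw [h.sum_eq] at h0
    simp only [hxJ, zero_smul, Finset.sum_const_zero, zero_add] at h0
    have hxJ' := hli _ h0
    have hz : Matrix.vecMul x (relMatrix lam β) = 0 := by
      ext i
      obtain ⟨s, rfl⟩ := h.2 i
      rcases s with a | b
      · exact hxJ a
      · exact hxJ' b
    refine hβ.det_last_ne_zero (Matrix.exists_vecMul_eq_zero_iff.1 ⟨x, hne, ?_⟩)
    ext a
    exact congrFun hz (Fin.natAdd d a)

/-- If the logarithmic derivatives `X^{γ_i} D_{ai}` of `g` functions are combinations
`∑_j C_{aj} X^{n_j λ̄_j} ℓ_{ji}` of the relations, then the minor of `D` with columns `J` is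
`X^{γ_0 + γ_{J'}}` times a scalar and `det C`, where `J'` is complementary to `J`. -/
theorem det_submatrix_eq_of_log_relation {R : Type*} [CommRing R]
    (X : Multiplicative (Fin d → ℚ) →* R) {J : Fin g ↪o Fin (d + g)} {J' : Fin d ↪o Fin (d + g)}
    (h : IsComplementary J J') (D : Matrix (Fin g) (Fin (d + g)) R) (C : Matrix (Fin g) (Fin g) R)
    (hD : ∀ a i, X (.ofAdd (gen lam i)) * D a i =
      ∑ j, C a j * X (.ofAdd (charIndex lam j • lamBar lam j)) * (relVec lam β j i : R)) :
    (D.submatrix id J).det = (((relVec lam β).submatrix id J).det : R) * C.det *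
      X (.ofAdd (gammaZero lam + ∑ b, gen lam (J' b))) := by
  have hprod : ∀ {m : ℕ} (w : Fin m → Fin d → ℚ),
      ∏ a, X (.ofAdd (w a)) = X (.ofAdd (∑ a, w a)) := fun w => by
    rw [ofAdd_sum, map_prod]
  have h1 : (∏ b, X (.ofAdd (gen lam (J b)))) * (D.submatrix id J).det =
      C.det * (∏ j : Fin g, X (.ofAdd (charIndex lam j • lamBar lam j))) *
        (((relVec lam β).submatrix id J).det : R) := by
    rw [← Matrix.det_mul_row, ← Matrix.det_diagonal, ← Matrix.det_mul]
    have e := (Int.castRingHom R).map_det ((relVec lam β).submatrix id J)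
    simp only [eq_intCast] at e
    rw [e, ← Matrix.det_mul]
    congr 1
    ext a b
    rw [Matrix.mul_apply]
    simp only [Matrix.of_apply, Matrix.submatrix_apply, id_eq, Matrix.mul_diagonal,
      RingHom.mapMatrix_apply, Matrix.map_apply, hD, Int.coe_castRingHom]
  rw [hprod, hprod, ← h.gammaZero_add, ofAdd_add, map_mul] at h1
  have hu : IsUnit (X (.ofAdd (∑ a, gen lam (J a)))) := (Group.isUnit _).map X
  refine hu.mul_left_cancel ?_
  rw [h1]; ring

/-- The normal form `nf` of an exponent depends only on its weight; `m α j` counts how often the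
`j`-th relation is used to reach it. -/
theorem IsRelation.exists_normalForm (hβ : IsRelation lam β) :
    ∃ (nf : (Fin d → ℚ) → Fin (d + g) → ℤ) (m : (Fin (d + g) →₀ ℕ) → Fin g → ℕ),
      (∀ α i, (α i : ℤ) = nf (weight lam α) i + ∑ j, (m α j : ℤ) * relVec lam β j i) ∧
      ∀ α j, m α j ≠ 0 →
        ∃ s ∈ semigroup lam, weight lam α = charIndex lam j • lamBar lam j + s := by
  classical
  choose r m hr hw hm hs using hβ.exists_reduced
  refine ⟨fun w i => if h : ∃ α, IsReduced lam α ∧ weight lam α = w then (h.choose i : ℤ) else 0,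
    m, fun α i => ?_, hs⟩
  have h : ∃ α', IsReduced lam α' ∧ weight lam α' = weight lam α := ⟨r α, hr α, hw α⟩
  have e : h.choose = r α :=
    h.choose_spec.1.eq_of_weight_eq (hr α) (h.choose_spec.2.trans (hw α).symm)
  simp only [dif_pos h, e, hm α i]

end Minors

/-! ### The Jacobian ideal of the affine variety -/

section AffineJacobian

variable {K : Type*} [Field K] {d g : ℕ} {lam : Fin g → Fin d → ℚ}
  {β : Fin g → Fin (d + g) →₀ ℕ}

theorem gen_natAdd (j : Fin g) : gen lam (Fin.natAdd d j) = lamBar lam j := by simp [gen]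

theorem coordInclusion_single (s : semigroup lam) (c : K) :
    coordInclusion K lam (AddMonoidAlgebra.single s c) =
      AddMonoidAlgebra.single (s : Fin d → ℚ) c := by
  rw [coordInclusion, AddMonoidAlgebra.mapDomainRingHom_apply, AddMonoidAlgebra.mapDomain_single]
  rfl

theorem coordInclusion_injective : Function.Injective (coordInclusion K lam) := by
  intro x y h
  rw [coordInclusion, AddMonoidAlgebra.mapDomainRingHom_apply,
    AddMonoidAlgebra.mapDomainRingHom_apply] at h
  exact AddMonoidAlgebra.mapDomain_injective Subtype.val_injective h

theorem toricEmbedding_monomial (α : Fin (d + g) →₀ ℕ) (c : K) :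
    coordInclusion K lam (toricEmbedding K lam (MvPolynomial.monomial α c)) =
      AddMonoidAlgebra.single (weight lam α) c := by
  rw [toricEmbedding, MvPolynomial.aeval_monomial, map_mul, Finsupp.prod_fintype _ _ (by simp),
    map_prod]
  simp only [coordInclusion_single, AddMonoidAlgebra.single_pow, one_pow]
  rw [AddMonoidAlgebra.coe_algebraMap, Function.comp_apply, coordInclusion_single]
  have : ∏ i, AddMonoidAlgebra.single (α i • gen lam i) (1 : K) =
      AddMonoidAlgebra.single (weight lam α) 1 := by
    change _ = AddMonoidAlgebra.of K (Fin d → ℚ) (.ofAdd (∑ i, α i • gen lam i))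
    rw [ofAdd_sum, map_prod]
    rfl
  refine (congrArg _ this).trans ?_
  rw [AddMonoidAlgebra.single_mul_single]
  simp

/-- The endomorphism `X^w ↦ c(w) X^w` of the additive group of `K[ℚ^d]`. -/
def coeffScale (K : Type*) [Field K] {d : ℕ} (c : (Fin d → ℚ) → K) :
    AddMonoidAlgebra K (Fin d → ℚ) →+ AddMonoidAlgebra K (Fin d → ℚ) :=
  (Finsupp.liftAddHom fun w =>
    (AddMonoidAlgebra.singleAddHom w).comp (AddMonoidHom.mulLeft (c w))).comp
      (AddMonoidAlgebra.coeffAddEquiv : AddMonoidAlgebra K (Fin d → ℚ) ≃+ _).toAddMonoidHom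

theorem coeffScale_single (c : (Fin d → ℚ) → K) (w : Fin d → ℚ) (a : K) :
    coeffScale K c (AddMonoidAlgebra.single w a) = AddMonoidAlgebra.single w (c w * a) := by
  simp only [coeffScale, AddMonoidHom.comp_apply]
  exact (Finsupp.liftAddHom_apply_single _ _ _)

/-- The logarithmic derivatives `X^{γ_i} ∂F/∂U_i` on `Z^Γ`, up to a term depending only on the
restriction of `F` to `Z^Γ`. -/
theorem IsRelation.exists_affine_log_relation (hβ : IsRelation lam β) :
    ∃ N : Fin (d + g) → AddMonoidAlgebra K (Fin d → ℚ) →+ AddMonoidAlgebra K (Fin d → ℚ),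
      ∀ F : MvPolynomial (Fin (d + g)) K, ∃ C : Fin g → CoordRing K lam, ∀ i,
        AddMonoidAlgebra.single (gen lam i) 1 *
            coordInclusion K lam (toricEmbedding K lam (MvPolynomial.pderiv i F)) =
          N i (coordInclusion K lam (toricEmbedding K lam F)) +
            ∑ j, coordInclusion K lam (C j) *
              AddMonoidAlgebra.single (charIndex lam j • lamBar lam j) 1 *
                (relVec lam β j i : AddMonoidAlgebra K (Fin d → ℚ)) := by
  obtain ⟨nf, m, hm, hs⟩ := hβ.exists_normalForm
  refine ⟨fun i => coeffScale K fun w => (nf w i : K), fun F => ?_⟩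
  induction F using MvPolynomial.induction_on' with
  | add F G hF hG =>
    obtain ⟨C, hC⟩ := hF
    obtain ⟨C', hC'⟩ := hG
    refine ⟨C + C', fun i => ?_⟩
    simp only [map_add, mul_add, hC, hC', Pi.add_apply, add_mul, Finset.sum_add_distrib]
    abel
  | monomial α c =>
    have hs' : ∀ j, ∃ s : semigroup lam, m α j ≠ 0 →
        weight lam α = charIndex lam j • lamBar lam j + s := by
      intro j
      by_cases h : m α j = 0
      · exact ⟨0, fun h' => absurd h h'⟩
      · obtain ⟨s, hs1, hs2⟩ := hs α j h
        exact ⟨⟨s, hs1⟩, fun _ => hs2⟩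
    choose s hs' using hs'
    refine ⟨fun j => AddMonoidAlgebra.single (s j) (m α j * c), fun i => ?_⟩
    have e1 : AddMonoidAlgebra.single (gen lam i) 1 *
            coordInclusion K lam (toricEmbedding K lam
              (MvPolynomial.pderiv i (MvPolynomial.monomial α c))) =
        AddMonoidAlgebra.single (weight lam α) (c * (α i : K)) := by
      rw [MvPolynomial.pderiv_monomial, toricEmbedding_monomial,
        AddMonoidAlgebra.single_mul_single, one_mul]
      by_cases h : α i = 0
      · simp [h]
      · congr 1
        rw [← one_smul ℕ (gen lam i), ← weight_single, ← map_add, add_tsub_cancel_of_le]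
        rw [Finsupp.single_le_iff]; omega
    have e2 : ∀ j, coordInclusion K lam (AddMonoidAlgebra.single (s j) (m α j * c)) *
              AddMonoidAlgebra.single (charIndex lam j • lamBar lam j) 1 *
                (relVec lam β j i : AddMonoidAlgebra K (Fin d → ℚ)) =
        AddMonoidAlgebra.single (weight lam α) (m α j * c * (relVec lam β j i : K)) := by
      intro j
      rw [coordInclusion_single, AddMonoidAlgebra.single_mul_single, mul_one]
      by_cases h : m α j = 0
      · simp [h]
      · rw [add_comm, ← hs' j h, AddMonoidAlgebra.intCast_def,
          AddMonoidAlgebra.single_mul_single, add_zero]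
    simp only [e1, e2, toricEmbedding_monomial, coeffScale_single]
    have hαi : (α i : K) = (nf (weight lam α) i : K) +
        ∑ j, (m α j : K) * (relVec lam β j i : K) := by
      have := congrArg (Int.cast : ℤ → K) (hm α i)
      push_cast at this
      exact this
    have hsum : ∀ x : Fin g → K, ∑ j, AddMonoidAlgebra.single (weight lam α) (x j) =
        AddMonoidAlgebra.single (weight lam α) (∑ j, x j) := fun x =>
      (map_sum (AddMonoidAlgebra.singleAddHom (weight lam α)) x _).symm
    rw [hsum, ← AddMonoidAlgebra.single_add, hαi]
    congr 1
    rw [mul_add, mul_comm c, Finset.mul_sum]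
    congr 1
    exact Finset.sum_congr rfl fun j _ => by ring

/-- The binomial `U_{d+j}^{n_j} - U^{β_j}`. -/
def relBinomial (K : Type*) [Field K] (lam : Fin g → Fin d → ℚ) (β : Fin g → Fin (d + g) →₀ ℕ)
    (j : Fin g) : MvPolynomial (Fin (d + g)) K :=
  MvPolynomial.monomial (Finsupp.single (Fin.natAdd d j) (charIndex lam j)) 1 -
    MvPolynomial.monomial (β j) 1

theorem IsRelation.toricEmbedding_relBinomial (hβ : IsRelation lam β) (j : Fin g) :
    toricEmbedding K lam (relBinomial K lam β j) = 0 := by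
  apply coordInclusion_injective
  rw [relBinomial, map_sub, map_sub, toricEmbedding_monomial, toricEmbedding_monomial,
    weight_single, (hβ j).1, map_zero, sub_eq_zero]
  simp [gen]

theorem monomial_pderiv_mul (i : Fin (d + g)) (α : Fin (d + g) →₀ ℕ) (c : K) :
    MvPolynomial.monomial (Finsupp.single i 1) 1 *
        MvPolynomial.pderiv i (MvPolynomial.monomial α c) =
      MvPolynomial.monomial α (c * (α i : K)) := by
  rw [MvPolynomial.pderiv_monomial, MvPolynomial.monomial_mul, one_mul]
  by_cases h : α i = 0
  · simp [h]
  · rw [add_tsub_cancel_of_le]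
    rw [Finsupp.single_le_iff]; omega

/-- The logarithmic derivatives of the binomials are the entries of the relation matrix. -/
theorem IsRelation.pderiv_relBinomial (hβ : IsRelation lam β) (i : Fin (d + g)) (j : Fin g) :
    AddMonoidAlgebra.single (gen lam i) 1 *
        coordInclusion K lam
          (toricEmbedding K lam (MvPolynomial.pderiv i (relBinomial K lam β j))) =
      AddMonoidAlgebra.single (charIndex lam j • lamBar lam j) 1 *
        (relVec lam β j i : AddMonoidAlgebra K (Fin d → ℚ)) := by
  have e : AddMonoidAlgebra.single (gen lam i) (1 : K) =
      coordInclusion K lam (toricEmbedding K lam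
        (MvPolynomial.monomial (Finsupp.single i 1) 1)) := by
    rw [toricEmbedding_monomial, weight_single, one_smul]
  rw [e, ← map_mul, ← map_mul, relBinomial, map_sub, mul_sub, monomial_pderiv_mul,
    monomial_pderiv_mul, map_sub, map_sub, toricEmbedding_monomial, toricEmbedding_monomial,
    (hβ j).1, weight_single, AddMonoidAlgebra.intCast_def, AddMonoidAlgebra.single_mul_single,
    add_zero, gen_natAdd]
  refine (map_sub (AddMonoidAlgebra.singleAddHom (R := K) (charIndex lam j • lamBar lam j))
    _ _).symm.trans ?_
  simp [relVec, Finsupp.single_apply, eq_comm]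

theorem intCast_ne_zero_of_charZero [CharZero K] {z : ℤ} (h : z ≠ 0) : (z : K) ≠ 0 := by
  exact_mod_cast h

variable [CharZero K]

theorem IsExponentChain.image_affineJacobian (h : IsExponentChain lam) :
    coordInclusion K lam '' (affineJacobian K lam) =
      (fun h => AddMonoidAlgebra.single (gammaZero lam) (1 : K) * coordInclusion K lam h) ''
        (affineLogJacobian K lam) := by
  obtain ⟨β, hβ⟩ := h.exists_isRelation
  have hgen : ∀ J' : Fin d ↪o Fin (d + g),
      coordInclusion K lam (AddMonoidAlgebra.single
        (∑ a, (⟨gen lam (J' a), gen_mem_semigroup lam (J' a)⟩ : semigroup lam)) (1 : K)) =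
      AddMonoidAlgebra.single (∑ b, gen lam (J' b)) 1 := by
    intro J'
    rw [coordInclusion_single]; simp
  apply Set.Subset.antisymm
  · rintro _ ⟨x, hx, rfl⟩
    change ∃ y ∈ affineLogJacobian K lam, AddMonoidAlgebra.single (gammaZero lam) (1 : K) *
      coordInclusion K lam y = coordInclusion K lam x
    refine Submodule.span_induction (p := fun x _ => ∃ y ∈ affineLogJacobian K lam,
      AddMonoidAlgebra.single (gammaZero lam) (1 : K) * coordInclusion K lam y =
        coordInclusion K lam x) ?_ ?_ ?_ ?_ hx
    · rintro _ ⟨F, hF, J, rfl⟩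
      obtain ⟨J', hJ⟩ := exists_isComplementary J
      obtain ⟨N, hN⟩ := hβ.exists_affine_log_relation (K := K)
      choose C hC using fun a => hN (F a)
      have key := det_submatrix_eq_of_log_relation
        (AddMonoidAlgebra.of K (Fin d → ℚ)) hJ (lam := lam) (β := β)
        (Matrix.of fun a i => coordInclusion K lam
          (toricEmbedding K lam (MvPolynomial.pderiv i (F a))))
        (Matrix.of fun a j => coordInclusion K lam (C a j)) (fun a i => by
          have := hC a i
          rw [hF a, map_zero, map_zero, zero_add] at this
          exact this)
      have e : coordInclusion K lam (toricEmbedding K lam (Matrix.det (Matrix.of fun a b =>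
          MvPolynomial.pderiv (J b) (F a)))) = ((Matrix.of fun a i => coordInclusion K lam
          (toricEmbedding K lam (MvPolynomial.pderiv i (F a)))).submatrix id J).det := by
        rw [AlgHom.map_det, RingHom.map_det]
        rfl
      have e2 : (Matrix.of fun a j => coordInclusion K lam (C a j)).det =
          coordInclusion K lam (Matrix.of C).det := by
        rw [RingHom.map_det]
        rfl
      rw [e, key, e2]
      by_cases hdet : ((relVec lam β).submatrix id J).det = 0
      · exact ⟨0, zero_mem _, by simp [hdet]⟩
      · refine ⟨((((relVec lam β).submatrix id J).det : CoordRing K lam) * (Matrix.of C).det) *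
          AddMonoidAlgebra.single
            (∑ a, (⟨gen lam (J' a), gen_mem_semigroup lam (J' a)⟩ : semigroup lam)) (1 : K),
          Ideal.mul_mem_left _ _ (Ideal.subset_span ⟨J', (hβ.det_ne_zero_iff hJ).1 hdet, rfl⟩), ?_⟩
        rw [map_mul, map_mul, map_intCast, hgen, ofAdd_add, map_mul]
        simp only [AddMonoidAlgebra.of_apply, toAdd_ofAdd]
        ring
    · exact ⟨0, zero_mem _, by simp⟩
    · rintro x y - - ⟨x', hx', ex⟩ ⟨y', hy', ey⟩
      exact ⟨x' + y', add_mem hx' hy', by rw [map_add, map_add, mul_add, ex, ey]⟩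
    · rintro a x - ⟨x', hx', ex⟩
      exact ⟨a * x', Ideal.mul_mem_left _ _ hx', by
        rw [smul_eq_mul, map_mul, map_mul, ← ex]; ring⟩
  · rintro _ ⟨y, hy, rfl⟩
    change ∃ x ∈ affineJacobian K lam, coordInclusion K lam x =
      AddMonoidAlgebra.single (gammaZero lam) (1 : K) * coordInclusion K lam y
    refine Submodule.span_induction (p := fun y _ => ∃ x ∈ affineJacobian K lam,
      coordInclusion K lam x = AddMonoidAlgebra.single (gammaZero lam) (1 : K) *
        coordInclusion K lam y) ?_ ?_ ?_ ?_ hy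
    · rintro _ ⟨J', hwedge, rfl⟩
      obtain ⟨J, hJ⟩ := exists_isComplementary' J'
      have hdet := (hβ.det_ne_zero_iff hJ).2 hwedge
      have key := det_submatrix_eq_of_log_relation
        (AddMonoidAlgebra.of K (Fin d → ℚ)) hJ (lam := lam) (β := β)
        (Matrix.of fun a i => coordInclusion K lam
          (toricEmbedding K lam (MvPolynomial.pderiv i (relBinomial K lam β a))))
        1 (fun a i => by
          have := hβ.pderiv_relBinomial (K := K) i a
          simp only [AddMonoidAlgebra.of_apply, toAdd_ofAdd, Matrix.of_apply, this]
          rw [Finset.sum_eq_single a]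
          · simp
          · intro b _ hb; simp [hb.symm]
          · simp)
      refine ⟨AddMonoidAlgebra.single 0 ((((relVec lam β).submatrix id J).det : K)⁻¹) *
        toricEmbedding K lam (Matrix.det (Matrix.of fun a b =>
          MvPolynomial.pderiv (J b) (relBinomial K lam β a))),
        Ideal.mul_mem_left _ _ (Ideal.subset_span ⟨_, hβ.toricEmbedding_relBinomial, J, rfl⟩), ?_⟩
      rw [map_mul, coordInclusion_single, AlgHom.map_det, RingHom.map_det, hgen]
      refine (congrArg _ key).trans ?_
      rw [Matrix.det_one, mul_one, AddMonoidAlgebra.intCast_def]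
      simp only [AddMonoidAlgebra.of_apply, toAdd_ofAdd, AddMonoidAlgebra.single_mul_single,
        ZeroMemClass.coe_zero, zero_add, mul_one]
      rw [inv_mul_cancel₀ (intCast_ne_zero_of_charZero hdet)]
    · exact ⟨0, zero_mem _, by simp⟩
    · rintro x y - - ⟨x', hx', ex⟩ ⟨y', hy', ey⟩
      exact ⟨x' + y', add_mem hx' hy', by rw [map_add, map_add, mul_add, ex, ey]⟩
    · rintro a x - ⟨x', hx', ex⟩
      exact ⟨a * x', Ideal.mul_mem_left _ _ hx', by
        rw [smul_eq_mul, map_mul, map_mul, ex]; ring⟩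

end AffineJacobian

/-! ### Operations on generalized power series -/

section Series

variable {K : Type*} [Field K] {d : ℕ}

/-- The monomials as a homomorphism from the exponents to the ambient ring. -/
def monoHom (K : Type*) [Field K] (d : ℕ) : Multiplicative (Fin d → ℚ) →* QSeries K d where
  toFun w := mono K w.toAdd
  map_one' := rfl
  map_mul' a b := by simp [mono]

theorem mono_add (a b : Fin d → ℚ) : mono K (a + b) = mono K a * mono K b :=
  (monoHom K d).map_mul (.ofAdd a) (.ofAdd b)

theorem mono_zero : mono K (0 : Fin d → ℚ) = 1 := rfl

theorem mono_sum {ι : Type*} (s : Finset ι) (w : ι → Fin d → ℚ) :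
    mono K (∑ i ∈ s, w i) = ∏ i ∈ s, mono K (w i) := by
  have := map_prod (monoHom K d) (fun i => .ofAdd (w i)) s
  rw [← ofAdd_sum] at this
  exact this

theorem mono_mul_coeff (a : Fin d → ℚ) (F : QSeries K d) (w : Fin d → ℚ) :
    (mono K a * F).coeff w = F.coeff (w - a) := by
  rw [mono, HahnSeries.coeff_single_mul, one_mul]

theorem mono_neg_mul_mono (a : Fin d → ℚ) : mono K (-a) * mono K a = 1 := by
  rw [← mono_add, neg_add_cancel, mono_zero]

theorem intCast_eq_C (z : ℤ) : (z : QSeries K d) = HahnSeries.C (z : K) :=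
  (map_intCast (HahnSeries.C : K →+* QSeries K d) z).symm

/-- Coefficientwise multiplication `∑ F_w X^w ↦ ∑ c(w) F_w X^w`. -/
def scaleCoeff (c : (Fin d → ℚ) → K) (F : QSeries K d) : QSeries K d where
  coeff w := c w * F.coeff w
  isPWO_support' := F.isPWO_support.mono fun w hw h0 => hw (by simp [h0])

@[simp] theorem scaleCoeff_coeff (c : (Fin d → ℚ) → K) (F : QSeries K d) (w : Fin d → ℚ) :
    (scaleCoeff c F).coeff w = c w * F.coeff w := rfl

theorem logDeriv_eq_scaleCoeff (l : (Fin d → ℚ) →ₗ[ℚ] ℚ) (F : QSeries K d) :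
    logDeriv l F = scaleCoeff (fun w => ((l w : ℚ) : K)) F := rfl

/-- The series with all exponents in `Λ`, without a convergence condition. -/
def supportedIn (K : Type*) [Field K] {d : ℕ} (Λ : AddSubmonoid (Fin d → ℚ)) :
    Subring (QSeries K d) where
  carrier := {F | ∀ w, F.coeff w ≠ 0 → w ∈ Λ}
  mul_mem' := by
    intro F G hF hG w hw
    obtain ⟨a, ha, b, hb, rfl⟩ := HahnSeries.support_mul_subset hw
    exact Λ.add_mem (hF a ha) (hG b hb)
  add_mem' := by
    intro F G hF hG w hw
    rcases HahnSeries.support_add_subset F G hw with h | h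
    · exact hF w h
    · exact hG w h
  one_mem' := by
    intro w hw
    have : w = 0 := by
      by_contra hne
      exact hw (by rw [HahnSeries.coeff_one, if_neg hne])
    rw [this]
    exact Λ.zero_mem
  zero_mem' := by intro w hw; exact absurd rfl hw
  neg_mem' := by
    intro F hF w hw
    exact hF w (by simpa using hw)

theorem det_mem_of_forall_mem {R : Type*} [CommRing R] (S : Subring R) {m : ℕ}
    (A : Matrix (Fin m) (Fin m) R) (h : ∀ i j, A i j ∈ S) : A.det ∈ S := by
  have : A = S.subtype.mapMatrix (Matrix.of fun i j => (⟨A i j, h i j⟩ : S)) := by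
    ext i j; rfl
  rw [this, ← RingHom.map_det]
  exact Subtype.prop _

variable {v : AbsoluteValue K ℝ}

theorem Converges.mono_mul {F : QSeries K d} (h : Converges v F) (a : Fin d → ℚ) :
    Converges v (mono K a * F) := by
  obtain ⟨r, hr, hs⟩ := h
  refine ⟨r, hr, ?_⟩
  rw [← (Equiv.addRight a).summable_iff]
  refine (hs.mul_right (r ^ ((∑ i, a i : ℚ) : ℝ))).congr fun w => ?_
  simp only [Function.comp_apply, Equiv.coe_addRight, mono_mul_coeff, add_sub_cancel_right,
    Pi.add_apply, Finset.sum_add_distrib]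
  push_cast
  rw [Real.rpow_add hr, mul_assoc]

theorem Converges.scaleCoeff {F : QSeries K d} (h : Converges v F) {c : (Fin d → ℚ) → K} {B : ℝ}
    (hc : ∀ w, v (c w) ≤ B) : Converges v (scaleCoeff c F) := by
  obtain ⟨r, hr, hs⟩ := h
  refine ⟨r, hr, Summable.of_nonneg_of_le (fun w => ?_) (fun w => ?_) (hs.mul_left B)⟩
  · exact mul_nonneg (v.nonneg _) (Real.rpow_nonneg hr.le _)
  · rw [scaleCoeff_coeff, map_mul, mul_assoc]
    exact mul_le_mul_of_nonneg_right (hc w)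
      (mul_nonneg (v.nonneg _) (Real.rpow_nonneg hr.le _))

theorem Converges.C_mul {F : QSeries K d} (h : Converges v F) (c : K) :
    Converges v (HahnSeries.C c * F) := by
  have : HahnSeries.C c * F = QuasiOrdinary.scaleCoeff (fun _ => c) F := by
    ext w; simp
  rw [this]
  exact h.scaleCoeff (B := v c) fun _ => le_rfl

theorem converges_mono (v : AbsoluteValue K ℝ) (a : Fin d → ℚ) : Converges v (mono K a) := by
  refine ⟨1, one_pos, summable_of_ne_finset_zero (s := {a}) fun w hw => ?_⟩
  rw [mono, HahnSeries.coeff_single_of_ne (by simpa using hw)]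
  simp

theorem mono_coeff_ne_zero {a w : Fin d → ℚ} (h : (mono K a).coeff w ≠ 0) : w = a := by
  by_contra hne
  exact h (by rw [mono, HahnSeries.coeff_single_of_ne hne])

end Series

/-! ### Restriction of power series to the germ -/

section Restriction

variable {K : Type*} [Field K] {d g : ℕ} {lam : Fin g → Fin d → ℚ}
  {β : Fin g → Fin (d + g) →₀ ℕ}

theorem IsExponentChain.weight_strictMono (h : IsExponentChain lam) : StrictMono (weight lam) := by
  intro α α' hα
  obtain ⟨ρ, rfl⟩ := exists_add_of_le hα.le
  rw [map_add]
  refine lt_add_of_pos_right _ ?_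
  have hρ : ρ ≠ 0 := by rintro rfl; simp at hα
  obtain ⟨i, hi⟩ := Finsupp.ne_iff.1 hρ
  rw [weight_apply]
  refine Finset.sum_pos' (fun i _ => nsmul_nonneg (h.gen_pos i).le _)
    ⟨i, Finset.mem_univ _, ?_⟩
  exact nsmul_pos (h.gen_pos i) hi

/-- By Dickson's lemma, since exponents of the same weight are incomparable. -/
theorem IsExponentChain.finite_fiber (h : IsExponentChain lam) (w : Fin d → ℚ) :
    {α : Fin (d + g) →₀ ℕ | weight lam α = w}.Finite := by
  refine IsAntichain.finite_of_partiallyWellOrderedOn ?_ (Set.isPWO_of_wellQuasiOrderedLE _)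
  intro α hα α' hα' hne hle
  have := h.weight_strictMono (lt_of_le_of_ne hle hne)
  rw [show weight lam α = w from hα, show weight lam α' = w from hα'] at this
  exact lt_irrefl _ this

/-- The finitely many exponents of weight `w`. -/
def IsExponentChain.fiber (h : IsExponentChain lam) (w : Fin d → ℚ) :
    Finset (Fin (d + g) →₀ ℕ) := (h.finite_fiber w).toFinset

theorem IsExponentChain.mem_fiber (h : IsExponentChain lam) {w : Fin d → ℚ}
    {α : Fin (d + g) →₀ ℕ} : α ∈ h.fiber w ↔ weight lam α = w := by
  simp [IsExponentChain.fiber]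

/-- The substitution `U_i = X^{γ_i}` in a formal power series. -/
def IsExponentChain.restrict (h : IsExponentChain lam) (F : MvPowerSeries (Fin (d + g)) K) :
    QSeries K d where
  coeff w := ∑ α ∈ h.fiber w, MvPowerSeries.coeff α F
  isPWO_support' := by
    refine ((Set.isPWO_of_wellQuasiOrderedLE Set.univ).image_of_monotone
      h.weight_strictMono.monotone).mono ?_
    intro w hw
    obtain ⟨α, hα, -⟩ := Finset.exists_ne_zero_of_sum_ne_zero hw
    exact ⟨α, trivial, h.mem_fiber.1 hα⟩

theorem IsExponentChain.restrict_coeff (h : IsExponentChain lam)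
    (F : MvPowerSeries (Fin (d + g)) K) (w : Fin d → ℚ) :
    (h.restrict F).coeff w = ∑ α ∈ h.fiber w, MvPowerSeries.coeff α F := rfl

theorem IsExponentChain.exists_of_restrict_coeff_ne_zero (h : IsExponentChain lam)
    {F : MvPowerSeries (Fin (d + g)) K} {w : Fin d → ℚ} (hw : (h.restrict F).coeff w ≠ 0) :
    ∃ α, weight lam α = w ∧ MvPowerSeries.coeff α F ≠ 0 := by
  obtain ⟨α, hα, h0⟩ := Finset.exists_ne_zero_of_sum_ne_zero hw
  exact ⟨α, h.mem_fiber.1 hα, h0⟩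

theorem IsExponentChain.isRestriction_iff (h : IsExponentChain lam)
    {F : MvPowerSeries (Fin (d + g)) K} {G : QSeries K d} :
    IsRestriction lam F G ↔ G = h.restrict F := by
  have e : ∀ w, ∑ᶠ (α : Fin (d + g) →₀ ℕ) (_ : ∑ i, α i • gen lam i = w),
      MvPowerSeries.coeff α F = (h.restrict F).coeff w := fun w =>
    finsum_cond_eq_sum_of_cond_iff _ fun {α} _ => h.mem_fiber.symm
  constructor
  · intro H
    ext w
    rw [H w, e]
  · rintro rfl w
    rw [e]

theorem IsExponentChain.restrict_add (h : IsExponentChain lam)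
    (F G : MvPowerSeries (Fin (d + g)) K) :
    h.restrict (F + G) = h.restrict F + h.restrict G := by
  ext w
  simp [h.restrict_coeff, Finset.sum_add_distrib]

theorem IsExponentChain.restrict_monomial (h : IsExponentChain lam) (α : Fin (d + g) →₀ ℕ)
    (c : K) : h.restrict (MvPowerSeries.monomial α c) = HahnSeries.single (weight lam α) c := by
  classical
  ext w
  rw [h.restrict_coeff]
  simp only [MvPowerSeries.coeff_monomial]
  rw [Finset.sum_ite_eq', HahnSeries.coeff_single]
  simp only [h.mem_fiber, @eq_comm _ w]

theorem IsExponentChain.restrict_mul (h : IsExponentChain lam)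
    (F G : MvPowerSeries (Fin (d + g)) K) :
    h.restrict (F * G) = h.restrict F * h.restrict G := by
  classical
  ext w
  -- the pairs of exponents of total weight `w`
  set P := (h.fiber w).biUnion fun α => Finset.HasAntidiagonal.antidiagonal α with hP
  have memP : ∀ x, x ∈ P ↔ weight lam x.1 + weight lam x.2 = w := by
    intro x
    simp only [hP, Finset.mem_biUnion, Finset.HasAntidiagonal.mem_antidiagonal, h.mem_fiber,
      ← map_add]
    exact ⟨fun ⟨α, h1, h2⟩ => by rw [h2, h1], fun H => ⟨_, H, rfl⟩⟩
  have e1 : (h.restrict (F * G)).coeff w =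
      ∑ x ∈ P, MvPowerSeries.coeff x.1 F * MvPowerSeries.coeff x.2 G := by
    rw [h.restrict_coeff, hP, Finset.sum_biUnion]
    · exact Finset.sum_congr rfl fun α _ => MvPowerSeries.coeff_mul _ _ _
    · intro a _ b _ hab
      refine Finset.disjoint_left.2 fun x hx hx' => hab ?_
      rw [← Finset.HasAntidiagonal.mem_antidiagonal.1 hx,
        ← Finset.HasAntidiagonal.mem_antidiagonal.1 hx']
  set φ : (Fin (d + g) →₀ ℕ) × (Fin (d + g) →₀ ℕ) → (Fin d → ℚ) × (Fin d → ℚ) :=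
    fun x => (weight lam x.1, weight lam x.2) with hφ
  rw [e1, HahnSeries.coeff_mul, ← Finset.sum_fiberwise_of_maps_to
    (t := P.image φ) (g := φ) fun x hx => Finset.mem_image_of_mem _ hx]
  have e2 : ∀ p ∈ P.image φ, ∑ x ∈ P with φ x = p,
      MvPowerSeries.coeff x.1 F * MvPowerSeries.coeff x.2 G =
      (h.restrict F).coeff p.1 * (h.restrict G).coeff p.2 := by
    intro p hp
    obtain ⟨y, hy, rfl⟩ := Finset.mem_image.1 hp
    rw [h.restrict_coeff, h.restrict_coeff, Finset.sum_mul_sum, ← Finset.sum_product']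
    refine Finset.sum_congr ?_ fun _ _ => rfl
    ext x
    simp only [Finset.mem_filter, memP, Finset.mem_product, h.mem_fiber, hφ, Prod.mk.injEq]
    constructor
    · exact fun H => H.2
    · exact fun H => ⟨by rw [H.1, H.2]; exact (memP y).1 hy, H⟩
  rw [Finset.sum_congr rfl e2]
  symm
  refine Finset.sum_subset ?_ ?_
  · intro p hp
    rw [Finset.mem_antidiagonal] at hp
    obtain ⟨α, hα, -⟩ := h.exists_of_restrict_coeff_ne_zero hp.1
    obtain ⟨α', hα', -⟩ := h.exists_of_restrict_coeff_ne_zero hp.2.1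
    refine Finset.mem_image.2 ⟨(α, α'), (memP _).2 ?_, ?_⟩
    · rw [hα, hα', hp.2.2]
    · exact Prod.ext hα hα'
  · intro p hp hp'
    by_contra hne
    obtain ⟨x, hx, rfl⟩ := Finset.mem_image.1 hp
    exact hp' (Finset.mem_antidiagonal.2
      ⟨left_ne_zero_of_mul hne, right_ne_zero_of_mul hne, (memP x).1 hx⟩)

/-- The substitution `U_i = X^{γ_i}` as a ring homomorphism. -/
def IsExponentChain.restrictHom (h : IsExponentChain lam) (K : Type*) [Field K] :
    MvPowerSeries (Fin (d + g)) K →+* QSeries K d where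
  toFun := h.restrict
  map_one' := by
    rw [← MvPowerSeries.monomial_zero_one, h.restrict_monomial, map_zero]
    rfl
  map_mul' := h.restrict_mul
  map_zero' := by
    ext w
    simp [h.restrict_coeff]
  map_add' := h.restrict_add

theorem IsExponentChain.restrictHom_apply (h : IsExponentChain lam)
    (F : MvPowerSeries (Fin (d + g)) K) : h.restrictHom K F = h.restrict F := rfl

/-- Multiplication of the coefficients of a power series in `U` by a function of the exponent. -/
def scaleMv {m : ℕ} (c : (Fin m →₀ ℕ) → K) (F : MvPowerSeries (Fin m) K) :
    MvPowerSeries (Fin m) K := fun α => c α * MvPowerSeries.coeff α F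

theorem coeff_scaleMv {m : ℕ} (c : (Fin m →₀ ℕ) → K) (F : MvPowerSeries (Fin m) K)
    (α : Fin m →₀ ℕ) : MvPowerSeries.coeff α (scaleMv c F) = c α * MvPowerSeries.coeff α F := rfl

/-- `X^{γ_i} ∂F/∂U_i` is the restriction of the logarithmic derivative `U_i ∂F/∂U_i`. -/
theorem IsExponentChain.mono_mul_restrict_pderiv (h : IsExponentChain lam)
    (F : MvPowerSeries (Fin (d + g)) K) (i : Fin (d + g)) :
    mono K (gen lam i) * h.restrict (MvPowerSeries.pderiv K i F) =
      h.restrict (scaleMv (fun α => (α i : K)) F) := by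
  ext w
  rw [mono_mul_coeff, h.restrict_coeff, h.restrict_coeff]
  refine Finset.sum_of_injOn (fun α => α + Finsupp.single i 1)
    (fun _ _ _ _ hab => add_right_cancel hab) ?_ ?_ ?_
  · intro α hα
    have := h.mem_fiber.1 hα
    refine h.mem_fiber.2 ?_
    rw [map_add, this, weight_single, one_smul, sub_add_cancel]
  · intro α hα hα'
    rw [coeff_scaleMv]
    by_cases hi : α i = 0
    · simp [hi]
    · refine absurd ⟨α - Finsupp.single i 1, ?_, ?_⟩ hα'
      · refine h.mem_fiber.2 ?_
        rw [eq_sub_iff_add_eq, ← one_smul ℕ (gen lam i), ← weight_single, ← map_add,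
          tsub_add_cancel_of_le, h.mem_fiber.1 hα]
        rw [Finsupp.single_le_iff]; omega
      · change α - Finsupp.single i 1 + Finsupp.single i 1 = α
        rw [tsub_add_cancel_of_le]
        rw [Finsupp.single_le_iff]; omega
  · intro α _
    rw [MvPowerSeries.coeff_pderiv, coeff_scaleMv]
    simp [mul_comm]

/-- For `F` in the formal ideal of the germ, the logarithmic derivatives of `F` along the `U_i` are
combinations of the relations, with coefficients divisible by `X^{n_j λ̄_j}`. -/
theorem IsRelation.exists_germ_log_relation (h : IsExponentChain lam) (hβ : IsRelation lam β)
    {F : MvPowerSeries (Fin (d + g)) K} (hF : h.restrict F = 0) :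
    ∃ C : Fin g → QSeries K d, (∀ j, C j ∈ supportedIn K (semigroup lam)) ∧
      ∀ i, mono K (gen lam i) * h.restrict (MvPowerSeries.pderiv K i F) =
        ∑ j, C j * mono K (charIndex lam j • lamBar lam j) * (relVec lam β j i : QSeries K d) := by
  obtain ⟨nf, m, hm, hs⟩ := hβ.exists_normalForm
  -- the terms of `F` of weight `w` contribute `nf w i` times the coefficient of `X^w` in the
  -- restriction of `F`, which is zero, and the relations used to reduce them
  refine ⟨fun j => mono K (-(charIndex lam j • lamBar lam j)) *
    h.restrict (scaleMv (fun α => (m α j : K)) F), fun j w hw => ?_, fun i => ?_⟩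
  · rw [mono_mul_coeff, sub_neg_eq_add] at hw
    obtain ⟨α, hα, hα0⟩ := h.exists_of_restrict_coeff_ne_zero hw
    rw [coeff_scaleMv] at hα0
    obtain ⟨s, hs1, hs2⟩ := hs α j fun h0 => hα0 (by simp [h0])
    rw [hα, add_comm] at hs2
    rwa [add_left_cancel hs2]
  · have e : ∀ j : Fin g, mono K (-(charIndex lam j • lamBar lam j)) *
        h.restrict (scaleMv (fun α => (m α j : K)) F) *
          mono K (charIndex lam j • lamBar lam j) * (relVec lam β j i : QSeries K d) =
        HahnSeries.C ((relVec lam β j i : ℤ) : K) *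
          h.restrict (scaleMv (fun α => (m α j : K)) F) := by
      intro j
      rw [mul_right_comm (mono K _), mono_neg_mul_mono, one_mul, mul_comm, intCast_eq_C]
    simp only [e]
    rw [h.mono_mul_restrict_pderiv]
    ext w
    have hFw : ∑ α ∈ h.fiber w, MvPowerSeries.coeff α F = 0 := by
      rw [← h.restrict_coeff, hF, HahnSeries.coeff_zero]
    rw [HahnSeries.coeff_sum]
    simp only [HahnSeries.C_mul_eq_smul, HahnSeries.coeff_smul, smul_eq_mul, h.restrict_coeff,
      coeff_scaleMv, Finset.mul_sum]
    rw [Finset.sum_comm]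
    have e2 : ∀ α ∈ h.fiber w, (α i : K) * MvPowerSeries.coeff α F =
        (nf w i : K) * MvPowerSeries.coeff α F +
          ∑ j, (relVec lam β j i : K) * ((m α j : K) * MvPowerSeries.coeff α F) := by
      intro α hα
      have h1 := congrArg (Int.cast : ℤ → K) (hm α i)
      rw [h.mem_fiber.1 hα] at h1
      push_cast at h1
      rw [h1, add_mul, Finset.sum_mul]
      congr 1
      exact Finset.sum_congr rfl fun j _ => by ring
    rw [Finset.sum_congr rfl e2, Finset.sum_add_distrib, ← Finset.mul_sum, hFw, mul_zero, zero_add]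

theorem IsExponentChain.restrict_mem_supportedIn (h : IsExponentChain lam)
    (F : MvPowerSeries (Fin (d + g)) K) : h.restrict F ∈ supportedIn K (semigroup lam) := by
  intro w hw
  obtain ⟨α, rfl, -⟩ := h.exists_of_restrict_coeff_ne_zero hw
  exact weight_mem_semigroup α

/-- The binomial `U_{d+j}^{n_j} - U^{β_j}` as a power series. -/
def relSeries (K : Type*) [Field K] (lam : Fin g → Fin d → ℚ) (β : Fin g → Fin (d + g) →₀ ℕ)
    (j : Fin g) : MvPowerSeries (Fin (d + g)) K :=
  MvPowerSeries.monomial (Finsupp.single (Fin.natAdd d j) (charIndex lam j)) 1 -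
    MvPowerSeries.monomial (β j) 1

theorem scaleMv_monomial {m : ℕ} (c : (Fin m →₀ ℕ) → K) (α : Fin m →₀ ℕ) (a : K) :
    scaleMv c (MvPowerSeries.monomial α a) = MvPowerSeries.monomial α (c α * a) := by
  classical
  ext α'
  rw [coeff_scaleMv, MvPowerSeries.coeff_monomial, MvPowerSeries.coeff_monomial]
  split_ifs with h
  · rw [h]
  · simp

theorem scaleMv_sub {m : ℕ} (c : (Fin m →₀ ℕ) → K) (F G : MvPowerSeries (Fin m) K) :
    scaleMv c (F - G) = scaleMv c F - scaleMv c G := by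
  ext α
  simp [coeff_scaleMv, mul_sub]

theorem IsExponentChain.restrict_sub (h : IsExponentChain lam)
    (F G : MvPowerSeries (Fin (d + g)) K) :
    h.restrict (F - G) = h.restrict F - h.restrict G := (h.restrictHom K).map_sub F G

theorem IsRelation.relSeries_mem_germIdeal (h : IsExponentChain lam) (hβ : IsRelation lam β)
    (v : AbsoluteValue K ℝ) (j : Fin g) : relSeries K lam β j ∈ germIdeal v lam := by
  classical
  refine ⟨⟨1, one_pos, summable_of_ne_finset_zero
    (s := {Finsupp.single (Fin.natAdd d j) (charIndex lam j), β j}) fun α hα => ?_⟩,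
    h.isRestriction_iff.2 ?_⟩
  · simp only [Finset.mem_insert, Finset.mem_singleton, not_or] at hα
    rw [relSeries, map_sub, MvPowerSeries.coeff_monomial, MvPowerSeries.coeff_monomial,
      if_neg hα.1, if_neg hα.2]
    simp
  · rw [relSeries, h.restrict_sub, h.restrict_monomial, h.restrict_monomial, (hβ j).1,
      weight_single, gen_natAdd, sub_self]

theorem IsRelation.restrict_pderiv_relSeries (h : IsExponentChain lam) (hβ : IsRelation lam β)
    (i : Fin (d + g)) (j : Fin g) :
    mono K (gen lam i) * h.restrict (MvPowerSeries.pderiv K i (relSeries K lam β j)) =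
      mono K (charIndex lam j • lamBar lam j) * (relVec lam β j i : QSeries K d) := by
  rw [h.mono_mul_restrict_pderiv, relSeries, scaleMv_sub, scaleMv_monomial, scaleMv_monomial,
    h.restrict_sub, h.restrict_monomial, h.restrict_monomial, (hβ j).1, weight_single, gen_natAdd,
    intCast_eq_C, HahnSeries.C_apply, mono, HahnSeries.single_mul_single, add_zero]
  refine (HahnSeries.single_sub _ _ _).symm.trans ?_
  simp [relVec, Finsupp.single_apply, eq_comm]

end Restriction

/-! ### The Jacobian ideal of the germ -/

section GermJacobian

variable {K : Type*} [Field K] {v : AbsoluteValue K ℝ} {d g : ℕ} {lam : Fin g → Fin d → ℚ}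

theorem mem_normalizedGerm_of_supportedIn (h : IsExponentChain lam) {F : QSeries K d}
    (hF : F ∈ supportedIn K (semigroup lam)) (hc : Converges v F) : F ∈ normalizedGerm v lam :=
  ⟨fun w hw => ⟨semigroup_le lam (hF w hw), h.nonneg_of_mem_semigroup (hF w hw)⟩, hc⟩

theorem mem_monomialGerm_of_supportedIn (h : IsExponentChain lam) {F : QSeries K d}
    (hF : F ∈ supportedIn K (semigroup lam)) (hc : Converges v F) : F ∈ monomialGerm v lam :=
  ⟨fun w hw => ⟨hF w hw, h.nonneg_of_mem_semigroup (hF w hw)⟩, hc⟩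

theorem mono_mem_supportedIn {Λ : AddSubmonoid (Fin d → ℚ)} {a : Fin d → ℚ} (ha : a ∈ Λ) :
    mono K a ∈ supportedIn K Λ := fun w hw => by
  rwa [mono_coeff_ne_zero hw]

theorem sum_gen_mem_semigroup {m : ℕ} (j : Fin m → Fin (d + g)) :
    ∑ a, gen lam (j a) ∈ semigroup lam := sum_mem fun a _ => gen_mem_semigroup lam (j a)

theorem IsExponentChain.mono_sum_gen_mem (h : IsExponentChain lam) (j : Fin d ↪o Fin (d + g)) :
    mono K (∑ a, gen lam (j a)) ∈ normalizedGerm v lam :=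
  mem_normalizedGerm_of_supportedIn h (mono_mem_supportedIn (sum_gen_mem_semigroup j))
    (converges_mono v _)

theorem IsExponentChain.mul_mono_mem_monomialIdeal (h : IsExponentChain lam)
    {j : Fin d ↪o Fin (d + g)} (hj : WedgeNeZero lam j) {y : normalizedGerm v lam}
    {F : QSeries K d} (hF : F ∈ normalizedGerm v lam)
    (hy : y.val = F * mono K (∑ a, gen lam (j a))) : y ∈ monomialIdeal v lam := by
  have e : y = ⟨F, hF⟩ * ⟨_, h.mono_sum_gen_mem j⟩ := Subtype.ext hy
  rw [e]
  exact Ideal.mul_mem_left _ _ (Ideal.subset_span ⟨j, hj, rfl⟩)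

/-- For an ideal `E`, it is enough to check `a x ∈ b E` on generators. -/
theorem exists_mul_val_eq_of_mem_span {R : Type*} [CommRing R] [Algebra K R] {A : Subalgebra K R}
    {S : Set A} {E : Ideal A} {a b : R} (H : ∀ x ∈ S, ∃ y ∈ E, a * x.val = b * y.val) {x : A}
    (hx : x ∈ Ideal.span S) : ∃ y ∈ E, a * x.val = b * y.val := by
  refine Submodule.span_induction (p := fun x _ => ∃ y ∈ E, a * x.val = b * y.val) H ?_ ?_ ?_ hx
  · exact ⟨0, zero_mem _, by simp⟩
  · rintro x y - - ⟨x', hx', ex⟩ ⟨y', hy', ey⟩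
    exact ⟨x' + y', add_mem hx' hy', by
      rw [Subalgebra.coe_add, Subalgebra.coe_add, mul_add, mul_add, ex, ey]⟩
  · rintro c x - ⟨x', hx', ex⟩
    exact ⟨c * x', Ideal.mul_mem_left _ _ hx', by
      rw [smul_eq_mul, Subalgebra.coe_mul, Subalgebra.coe_mul, mul_left_comm, ex, mul_left_comm]⟩

theorem IsExponentChain.restrict_det (h : IsExponentChain lam)
    (F : Fin g → MvPowerSeries (Fin (d + g)) K) (J : Fin g ↪o Fin (d + g)) :
    h.restrict (Matrix.det (Matrix.of fun a b => MvPowerSeries.pderiv K (J b) (F a))) =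
      ((Matrix.of fun a i => h.restrict (MvPowerSeries.pderiv K i (F a))).submatrix id J).det := by
  rw [← h.restrictHom_apply, RingHom.map_det]
  rfl

variable [CharZero K]

theorem intCast_mul_C_inv {z : ℤ} (hz : z ≠ 0) :
    HahnSeries.C ((z : K)⁻¹) * (z : QSeries K d) = 1 := by
  rw [intCast_eq_C, ← map_mul, inv_mul_cancel₀ (intCast_ne_zero_of_charZero hz), map_one]

/-- The generators of `Jac(S_0)` lie in `X^{γ_0} I_g`.  The cofactor of `X^{γ_0 + γ_{J'}}` is the
determinant of the coefficients of the relations; it converges because the minor does. -/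
theorem IsExponentChain.exists_of_mem_germJacobian_generator (h : IsExponentChain lam)
    {x : monomialGerm v lam} {F : Fin g → MvPowerSeries (Fin (d + g)) K}
    (hF : ∀ a, F a ∈ germIdeal v lam) {J : Fin g ↪o Fin (d + g)}
    (hx : IsRestriction lam
      (Matrix.det (Matrix.of fun a b => MvPowerSeries.pderiv K (J b) (F a))) x.val) :
    ∃ y ∈ monomialIdeal v lam, x.val = mono K (gammaZero lam) * y.val := by
  obtain ⟨β, hβ⟩ := h.exists_isRelation
  obtain ⟨J', hJ⟩ := exists_isComplementary J
  choose C hC hCD using fun a =>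
    hβ.exists_germ_log_relation h (h.isRestriction_iff.1 (hF a).2).symm
  have key := det_submatrix_eq_of_log_relation (monoHom K d) hJ (lam := lam) (β := β)
    (Matrix.of fun a i => h.restrict (MvPowerSeries.pderiv K i (F a))) (Matrix.of C)
    (fun a i => hCD a i)
  rw [h.isRestriction_iff, h.restrict_det, key] at hx
  set z := ((relVec lam β).submatrix id J).det with hz
  have hx' : x.val = (z : QSeries K d) * (Matrix.of C).det *
      mono K (gammaZero lam + ∑ b, gen lam (J' b)) := hx
  by_cases hdet : z = 0
  · exact ⟨0, zero_mem _, by rw [hx', hdet]; simp⟩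
  have hDs : (Matrix.of C).det ∈ supportedIn K (semigroup lam) :=
    det_mem_of_forall_mem _ _ fun a j => hC a j
  have hDc : Converges v (Matrix.of C).det := by
    have e : (Matrix.of C).det = HahnSeries.C ((z : K)⁻¹) *
        (mono K (-(gammaZero lam + ∑ b, gen lam (J' b))) * x.val) := by
      rw [hx', mul_left_comm (mono K _), mul_comm (mono K _) (mono K _), mono_add,
        neg_add, mono_add]
      have e1 := mono_neg_mul_mono (K := K) (gammaZero lam)
      have e2 := mono_neg_mul_mono (K := K) (∑ b, gen lam (J' b))
      have e3 := intCast_mul_C_inv (K := K) (d := d) hdet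
      calc (Matrix.of C).det = (HahnSeries.C ((z : K)⁻¹) * (z : QSeries K d)) *
            (mono K (-gammaZero lam) * mono K (gammaZero lam)) *
            (mono K (-∑ b, gen lam (J' b)) * mono K (∑ b, gen lam (J' b))) *
            (Matrix.of C).det := by rw [e1, e2, e3]; simp
        _ = _ := by ring
    rw [e]
    exact (x.2.2.mono_mul _).C_mul _
  have hzs : (z : QSeries K d) * (Matrix.of C).det ∈ normalizedGerm v lam := by
    refine mem_normalizedGerm_of_supportedIn h (mul_mem (intCast_mem _ z) hDs) ?_
    rw [intCast_eq_C]
    exact hDc.C_mul _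
  have hys : (z : QSeries K d) * (Matrix.of C).det * mono K (∑ b, gen lam (J' b)) ∈
      normalizedGerm v lam := mul_mem hzs (h.mono_sum_gen_mem J')
  refine ⟨⟨_, hys⟩, h.mul_mono_mem_monomialIdeal ((hβ.det_ne_zero_iff hJ).1 hdet) hzs rfl, ?_⟩
  rw [hx', mono_add]
  ring

/-- The minors of the binomials `U_{d+j}^{n_j} - U^{β_j}` give all generators of `X^{γ_0} I_g`. -/
theorem IsExponentChain.exists_mem_germJacobian (h : IsExponentChain lam)
    {J' : Fin d ↪o Fin (d + g)} (hwedge : WedgeNeZero lam J') :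
    ∃ x ∈ germJacobian v lam,
      x.val = mono K (gammaZero lam) * mono K (∑ a, gen lam (J' a)) := by
  obtain ⟨β, hβ⟩ := h.exists_isRelation
  obtain ⟨J, hJ⟩ := exists_isComplementary' J'
  have hdet := (hβ.det_ne_zero_iff hJ).2 hwedge
  have key := det_submatrix_eq_of_log_relation (monoHom K d) hJ (lam := lam) (β := β)
    (Matrix.of fun a i => h.restrict (MvPowerSeries.pderiv K i (relSeries K lam β a)))
    1 (fun a i => by
      have := hβ.restrict_pderiv_relSeries (K := K) h i a
      refine this.trans ?_
      rw [Finset.sum_eq_single a]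
      · simp only [Matrix.one_apply_eq, one_mul]
        rfl
      · intro b _ hb; simp [hb.symm]
      · simp)
  rw [← h.restrict_det, Matrix.det_one, mul_one] at key
  set z := ((relVec lam β).submatrix id J).det with hz
  have key' : h.restrict (Matrix.det (Matrix.of fun a b =>
      MvPowerSeries.pderiv K (J b) (relSeries K lam β a))) =
      (z : QSeries K d) * mono K (gammaZero lam + ∑ b, gen lam (J' b)) := key
  have hmem : h.restrict (Matrix.det (Matrix.of fun a b =>
      MvPowerSeries.pderiv K (J b) (relSeries K lam β a))) ∈ monomialGerm v lam := by
    refine mem_monomialGerm_of_supportedIn h (h.restrict_mem_supportedIn _) ?_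
    rw [key', intCast_eq_C]
    exact (converges_mono v _).C_mul _
  refine ⟨algebraMap K _ ((z : K)⁻¹) * ⟨_, hmem⟩,
    Ideal.mul_mem_left _ _ (Ideal.subset_span
      ⟨relSeries K lam β, hβ.relSeries_mem_germIdeal h v, J, h.isRestriction_iff.2 rfl⟩), ?_⟩
  rw [Subalgebra.coe_mul]
  change HahnSeries.C ((z : K)⁻¹) * h.restrict _ = _
  rw [key', ← mul_assoc, intCast_mul_C_inv hdet, one_mul, mono_add]

theorem IsExponentChain.image_germJacobian (h : IsExponentChain lam) :
    Subtype.val '' (((germJacobian v lam).map (normalization v lam) :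
        Ideal (normalizedGerm v lam)) : Set (normalizedGerm v lam)) =
      monoMul v lam (gammaZero lam) (monomialIdeal v lam) := by
  apply Set.Subset.antisymm
  · rintro _ ⟨x, hx, rfl⟩
    rw [germJacobian, Ideal.map_span] at hx
    obtain ⟨y, hy, hxy⟩ := exists_mul_val_eq_of_mem_span (a := 1) (b := mono K (gammaZero lam))
      (E := monomialIdeal v lam) (by
        rintro _ ⟨x, ⟨F, hF, J, hx⟩, rfl⟩
        obtain ⟨y, hy, hxy⟩ := h.exists_of_mem_germJacobian_generator hF hx
        exact ⟨y, hy, (one_mul _).trans hxy⟩) hx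
    exact ⟨y, hy, (one_mul _).symm.trans hxy⟩
  · rintro _ ⟨y, hy, rfl⟩
    obtain ⟨x, hx, hxy⟩ := exists_mul_val_eq_of_mem_span (a := mono K (gammaZero lam)) (b := 1)
      (E := Ideal.map (normalization v lam) (germJacobian v lam)) (by
        rintro y ⟨J', hwedge, hy⟩
        obtain ⟨x, hx, hxy⟩ := h.exists_mem_germJacobian (K := K) (v := v) hwedge
        refine ⟨normalization v lam x, Ideal.mem_map_of_mem _ hx, ?_⟩
        rw [hy, one_mul]
        exact hxy.symm) hy
    exact ⟨x, hx, (one_mul _).symm.trans hxy.symm⟩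

end GermJacobian

/-! ### The logarithmic Jacobian ideal of the germ -/

section GermLogJacobian

variable {K : Type*} [Field K] {v : AbsoluteValue K ℝ} {d g : ℕ} {lam : Fin g → Fin d → ℚ}

/-- Membership in the monomial ideal `I_g` can be read off from the exponents: the series is split
into finitely many parts, one for each generator. -/
theorem IsExponentChain.mem_monomialIdeal (h : IsExponentChain lam) {y : normalizedGerm v lam}
    (hy : ∀ w, y.val.coeff w ≠ 0 → ∃ j : Fin d ↪o Fin (d + g), WedgeNeZero lam j ∧
      w - ∑ a, gen lam (j a) ∈ semigroup lam) : y ∈ monomialIdeal v lam := by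
  classical
  suffices H : ∀ (T : Finset (Fin d ↪o Fin (d + g))) (y : normalizedGerm v lam),
      (∀ w, y.val.coeff w ≠ 0 → ∃ j ∈ T, WedgeNeZero lam j ∧
        w - ∑ a, gen lam (j a) ∈ semigroup lam) → y ∈ monomialIdeal v lam from
    H Finset.univ y fun w hw => by simpa using hy w hw
  clear hy y
  intro T
  induction T using Finset.induction_on with
  | empty =>
    intro y hy
    have : y = 0 := by
      refine Subtype.ext (HahnSeries.ext (funext fun w => ?_))
      by_contra hw
      obtain ⟨j, hj, -⟩ := hy w hw
      simp at hj
    rw [this]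
    exact zero_mem _
  | insert j T _ ih =>
    intro y hy
    by_cases hj : WedgeNeZero lam j
    swap
    · refine ih y fun w hw => ?_
      obtain ⟨j', hj', hw1, hw2⟩ := hy w hw
      rcases Finset.mem_insert.1 hj' with rfl | h'
      · exact absurd hw1 hj
      · exact ⟨j', h', hw1, hw2⟩
    set p : (Fin d → ℚ) → K := fun w =>
      if w - ∑ a, gen lam (j a) ∈ semigroup lam then 1 else 0 with hp
    have hpv : ∀ w, v (p w) ≤ 1 := fun w => by
      simp only [hp]; split_ifs <;> simp
    have hpc : Converges v (scaleCoeff p y.val) := y.2.2.scaleCoeff hpv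
    have hpm : scaleCoeff p y.val ∈ normalizedGerm v lam :=
      ⟨fun w hw => y.2.1 w (right_ne_zero_of_mul hw), hpc⟩
    have h1 : (⟨_, hpm⟩ : normalizedGerm v lam) ∈ monomialIdeal v lam := by
      refine h.mul_mono_mem_monomialIdeal hj
        (F := mono K (-∑ a, gen lam (j a)) * scaleCoeff p y.val) ?_ ?_
      · refine mem_normalizedGerm_of_supportedIn h (fun w hw => ?_) (hpc.mono_mul _)
        rw [mono_mul_coeff, sub_neg_eq_add, scaleCoeff_coeff] at hw
        have hw' := left_ne_zero_of_mul hw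
        simp only [hp, ne_eq, ite_eq_right_iff, one_ne_zero, imp_false, not_not] at hw'
        simpa using hw'
      · rw [mul_right_comm, mono_neg_mul_mono, one_mul]
    have h2 : y - ⟨_, hpm⟩ ∈ monomialIdeal v lam := by
      refine ih _ fun w hw => ?_
      have e : (y - ⟨_, hpm⟩ : normalizedGerm v lam).val.coeff w = (1 - p w) * y.val.coeff w := by
        rw [Subalgebra.coe_sub, HahnSeries.coeff_sub, scaleCoeff_coeff]; ring
      rw [e] at hw
      obtain ⟨j', hj', hw1, hw2⟩ := hy w (right_ne_zero_of_mul hw)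
      rcases Finset.mem_insert.1 hj' with rfl | h'
      · exact absurd (by simp [hp, hw2]) (left_ne_zero_of_mul hw)
      · exact ⟨j', h', hw1, hw2⟩
    simpa using add_mem h2 h1

/-- A series with exponents in `Γ` has logarithmic derivatives `∑_k ℓ(γ_k) X^{γ_k} D_k`. -/
theorem exists_logDeriv_eq_sum {F : QSeries K d} (hF : F ∈ supportedIn K (semigroup lam))
    [CharZero K] :
    ∃ D : Fin (d + g) → QSeries K d, (∀ k, D k ∈ supportedIn K (semigroup lam)) ∧
      ∀ l : (Fin d → ℚ) →ₗ[ℚ] ℚ, logDeriv l F =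
        ∑ k, HahnSeries.C ((l (gen lam k) : ℚ) : K) * (mono K (gen lam k) * D k) := by
  have : ∀ w, ∃ α : Fin (d + g) →₀ ℕ, w ∈ semigroup lam → weight lam α = w := by
    intro w
    by_cases hw : w ∈ semigroup lam
    · obtain ⟨α, hα⟩ := mem_semigroup_iff.1 hw
      exact ⟨α, fun _ => hα⟩
    · exact ⟨0, fun h => absurd h hw⟩
  -- `a w` is an exponent in the variables `U_i` of the monomial `X^w`
  choose a ha using this
  refine ⟨fun k => mono K (-gen lam k) * scaleCoeff (fun w => (a w k : K)) F, fun k w hw => ?_,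
    fun l => ?_⟩
  · rw [mono_mul_coeff, sub_neg_eq_add, scaleCoeff_coeff] at hw
    have hw1 := ha _ (hF _ (right_ne_zero_of_mul hw))
    have hw2 : a (w + gen lam k) k ≠ 0 := fun h0 => left_ne_zero_of_mul hw (by simp [h0])
    have hle : Finsupp.single k 1 ≤ a (w + gen lam k) := by
      rw [Finsupp.single_le_iff]; omega
    obtain ⟨ρ, hρ⟩ := exists_add_of_le hle
    rw [hρ, map_add, weight_single, one_smul, add_comm w] at hw1
    rw [← add_left_cancel hw1]
    exact weight_mem_semigroup ρ
  · have e : ∀ k, mono K (gen lam k) * (mono K (-gen lam k) *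
        scaleCoeff (fun w => (a w k : K)) F) = scaleCoeff (fun w => (a w k : K)) F := fun k => by
      rw [← mul_assoc, mul_comm (mono K _), mono_neg_mul_mono, one_mul]
    simp only [e]
    ext w
    rw [HahnSeries.coeff_sum, logDeriv_eq_scaleCoeff, scaleCoeff_coeff]
    simp only [HahnSeries.C_mul_eq_smul, HahnSeries.coeff_smul, smul_eq_mul, scaleCoeff_coeff]
    by_cases hw : F.coeff w = 0
    · simp [hw]
    simp only [← mul_assoc, ← Finset.sum_mul]
    congr 1
    conv_lhs => rw [← ha w (hF w hw)]
    rw [weight_apply, map_sum]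
    push_cast
    exact Finset.sum_congr rfl fun k _ => by
      rw [map_nsmul, nsmul_eq_mul]; push_cast; ring

/-- Multilinear expansion of the determinant of a product of rectangular matrices. -/
theorem det_of_sum_columns {R : Type*} [CommRing R] {m n : ℕ} (A : Fin n → Fin m → R)
    (B : Fin m → Fin n → R) :
    (Matrix.of fun i j => ∑ k, A i k * B k j).det =
      ∑ k : Fin n → Fin m, (∏ j, B (k j) j) * (Matrix.of fun i j => A i (k j)).det := by
  rw [← Matrix.det_transpose]
  have e : (Matrix.of fun i j => ∑ k, A i k * B k j).transpose =
      fun j => ∑ k, fun i => A i k * B k j := by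
    ext j i
    simp [Finset.sum_apply]
  rw [e]
  refine (Matrix.detRowAlternating.toMultilinearMap.map_sum _).trans ?_
  refine Finset.sum_congr rfl fun k _ => ?_
  rw [← Matrix.det_mul_row, ← Matrix.det_transpose]
  change Matrix.det _ = Matrix.det _
  congr 1
  ext j i
  simp [mul_comm]

variable [CharZero K]

/-- The matrix of the coordinates of the vectors `γ_{k_j}` with respect to a basis. -/
abbrev coordMatrix (lam : Fin g → Fin d → ℚ) (u : Module.Basis (Fin d) ℚ (Fin d → ℚ))
    (k : Fin d → Fin (d + g)) : Matrix (Fin d) (Fin d) ℚ :=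
  Matrix.of fun i j => u.coord i (gen lam (k j))

theorem det_coordMatrix_ne_zero_iff (u : Module.Basis (Fin d) ℚ (Fin d → ℚ))
    (k : Fin d → Fin (d + g)) :
    (coordMatrix lam u k).det ≠ 0 ↔ LinearIndependent ℚ fun a => gen lam (k a) := by
  have e : (coordMatrix lam u k).det = u.det fun a => gen lam (k a) := by
    rw [Module.Basis.det_apply]
    rfl
  rw [e, ← isUnit_iff_ne_zero, ← Module.Basis.is_basis_iff_det]
  exact ⟨fun h => h.1, fun h => ⟨h, h.span_eq_top_of_card_eq_finrank' (by simp)⟩⟩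

theorem det_C_coordMatrix (u : Module.Basis (Fin d) ℚ (Fin d → ℚ)) (k : Fin d → Fin (d + g)) :
    (Matrix.of fun i j => (HahnSeries.C ((u.coord i (gen lam (k j)) : ℚ) : K) : QSeries K d)).det =
      HahnSeries.C (((coordMatrix lam u k).det : ℚ) : K) := by
  have := ((HahnSeries.C : K →+* QSeries K d).comp (algebraMap ℚ K)).map_det (coordMatrix lam u k)
  simp only [RingHom.comp_apply, eq_ratCast] at this
  rw [this]
  congr 1

theorem exists_orderEmb_of_linearIndependent {k : Fin d → Fin (d + g)}
    (hk : LinearIndependent ℚ fun a => gen lam (k a)) :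
    ∃ j : Fin d ↪o Fin (d + g), WedgeNeZero lam j ∧
      ∑ a, gen lam (j a) = ∑ a, gen lam (k a) := by
  have hinj : Function.Injective k := fun a b hab => hk.injective (by simp [hab])
  have hs : StrictMono (k ∘ Tuple.sort k) :=
    (Tuple.monotone_sort k).strictMono_of_injective (hinj.comp (Tuple.sort k).injective)
  refine ⟨OrderEmbedding.ofStrictMono _ hs, wedgeNeZero_iff_linearIndependent.2 ?_, ?_⟩
  · exact hk.comp _ (Tuple.sort k).injective
  · exact Equiv.sum_comp (Tuple.sort k) fun a => gen lam (k a)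

theorem IsExponentChain.germLogJacobian_eq (h : IsExponentChain lam)
    (u : Module.Basis (Fin d) ℚ (Fin d → ℚ)) :
    germLogJacobian v lam u = monomialIdeal v lam := by
  apply le_antisymm
  · refine Ideal.span_le.2 ?_
    rintro y ⟨f, hy⟩
    refine h.mem_monomialIdeal fun w hw => ?_
    choose D hD hlog using fun j =>
      exists_logDeriv_eq_sum (lam := lam) (F := (f j).val) fun w hw => ((f j).2.1 w hw).1
    simp only [hlog] at hy
    rw [hy, det_of_sum_columns (fun i k => HahnSeries.C ((u.coord i (gen lam k) : ℚ) : K))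
      (fun k j => mono K (gen lam k) * D j k), HahnSeries.coeff_sum] at hw
    obtain ⟨k, -, hk⟩ := Finset.exists_ne_zero_of_sum_ne_zero hw
    rw [det_C_coordMatrix] at hk
    have hdet : (coordMatrix lam u k).det ≠ 0 := by
      intro h0
      rw [h0] at hk
      simp at hk
    obtain ⟨j, hj, hsum⟩ :=
      exists_orderEmb_of_linearIndependent ((det_coordMatrix_ne_zero_iff u k).1 hdet)
    refine ⟨j, hj, ?_⟩
    rw [mul_comm, HahnSeries.C_mul_eq_smul, HahnSeries.coeff_smul, Finset.prod_mul_distrib,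
      ← mono_sum, mono_mul_coeff, ← hsum] at hk
    have hprod : ∏ j, D j (k j) ∈ supportedIn K (semigroup lam) :=
      Subring.prod_mem _ fun j _ => hD j (k j)
    exact hprod _ fun h0 => hk (by rw [h0, smul_zero])
  · refine Ideal.span_le.2 ?_
    rintro y ⟨j, hj, hy⟩
    have hdet := (det_coordMatrix_ne_zero_iff u j).2 (wedgeNeZero_iff_linearIndependent.1 hj)
    have hdetK : (((coordMatrix lam u j).det : ℚ) : K) ≠ 0 := by exact_mod_cast hdet
    have hmem : ∀ a, mono K (gen lam (j a)) ∈ monomialGerm v lam := fun a =>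
      mem_monomialGerm_of_supportedIn h (mono_mem_supportedIn (gen_mem_semigroup lam _))
        (converges_mono v _)
    have hlog : ∀ (l : (Fin d → ℚ) →ₗ[ℚ] ℚ) (w : Fin d → ℚ), logDeriv l (mono K w) =
        mono K w * HahnSeries.C ((l w : ℚ) : K) := by
      intro l w
      rw [mul_comm, HahnSeries.C_mul_eq_smul]
      ext w'
      rw [logDeriv_eq_scaleCoeff, scaleCoeff_coeff, HahnSeries.coeff_smul, smul_eq_mul]
      by_cases hw' : (mono K w).coeff w' = 0
      · simp [hw']
      · rw [mono_coeff_ne_zero hw']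
    have hval : HahnSeries.C (((coordMatrix lam u j).det : ℚ) : K) * y.val =
        Matrix.det (Matrix.of fun i a => logDeriv (u.coord i) (mono K (gen lam (j a)))) := by
      simp only [hlog]
      refine Eq.trans ?_ (Matrix.det_mul_row _ _).symm
      rw [← mono_sum, hy, mul_comm]
      exact congrArg _ (det_C_coordMatrix u j).symm
    have e : y = algebraMap K _ ((((coordMatrix lam u j).det : ℚ) : K)⁻¹) *
        (algebraMap K _ (((coordMatrix lam u j).det : ℚ) : K) * y) := by
      rw [← mul_assoc, ← map_mul, inv_mul_cancel₀ hdetK, map_one, one_mul]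
    rw [SetLike.mem_coe, e]
    exact Ideal.mul_mem_left _ _ (Ideal.subset_span ⟨fun a => ⟨_, hmem a⟩, hval⟩)

end GermLogJacobian

/-! ### Dominant exponents -/

section Dominant

variable {K : Type*} [Field K] {d : ℕ}

/-- The exponent `w` occurs in `F` and is the smallest one, i.e. `F = X^w G` where `G` has
non-negative exponents and `G(0) ≠ 0`. -/
def IsDominant (F : QSeries K d) (w : Fin d → ℚ) : Prop :=
  F.coeff w ≠ 0 ∧ ∀ w', F.coeff w' ≠ 0 → w ≤ w'

theorem IsDominant.unique {F : QSeries K d} {w w' : Fin d → ℚ} (h : IsDominant F w)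
    (h' : IsDominant F w') : w = w' := le_antisymm (h.2 _ h'.1) (h'.2 _ h.1)

theorem exists_minimal_exponent {L : Type*} [LinearOrder L] {φ : (Fin d → ℚ) → L}
    (hφ : Monotone φ) {F : QSeries K d} (hF : F ≠ 0) :
    ∃ w, F.coeff w ≠ 0 ∧ ∀ w', F.coeff w' ≠ 0 → φ w ≤ φ w' := by
  have hwf := (F.isPWO_support.image_of_monotone hφ).isWF
  have hne : (φ '' F.support).Nonempty := (HahnSeries.support_nonempty_iff.2 hF).image φ
  obtain ⟨w, hw, hmin⟩ := hwf.min_mem hne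
  refine ⟨w, hw, fun w' hw' => ?_⟩
  rw [hmin]
  exact hwf.min_le hne ⟨w', hw', rfl⟩

/-- The leading coefficients with respect to a linear order compatible with addition multiply. -/
theorem coeff_mul_of_minimal {L : Type*} [AddCommMonoid L] [LinearOrder L]
    [IsOrderedCancelAddMonoid L] {φ : (Fin d → ℚ) →+ L} (hφ : Function.Injective φ)
    {F G : QSeries K d} {a b : Fin d → ℚ} (ha : ∀ w, F.coeff w ≠ 0 → φ a ≤ φ w)
    (hb : ∀ w, G.coeff w ≠ 0 → φ b ≤ φ w) :
    (F * G).coeff (a + b) = F.coeff a * G.coeff b := by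
  rw [HahnSeries.coeff_mul, Finset.sum_eq_single (a, b)]
  · rintro ⟨x, y⟩ hxy hne
    exfalso
    rw [Finset.mem_antidiagonal] at hxy
    obtain ⟨hx, hy, hs⟩ := hxy
    have h1 := ha x hx
    have h2 := hb y hy
    have h3 : φ x + φ y = φ a + φ b := by rw [← map_add, ← map_add]; exact congrArg φ hs
    have h4 : φ x = φ a := by
      refine le_antisymm ?_ h1
      by_contra hlt
      exact absurd h3 (add_lt_add_of_lt_of_le (not_le.1 hlt) h2).ne'
    have h5 : φ y = φ b := by
      rw [h4] at h3
      exact add_left_cancel h3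
    exact hne (Prod.ext (hφ h4) (hφ h5))
  · intro h
    by_contra hne
    exact h (Finset.mem_antidiagonal.2 ⟨left_ne_zero_of_mul hne, right_ne_zero_of_mul hne, rfl⟩)

/-- The lexicographic order of the exponents as an additive map. -/
def lexHom (d : ℕ) : (Fin d → ℚ) →+ Lex (Fin d → ℚ) where
  toFun := toLex
  map_zero' := rfl
  map_add' _ _ := rfl

theorem lexHom_injective : Function.Injective (lexHom d) := toLex.injective

theorem lexHom_monotone : Monotone (lexHom d) := Pi.toLex_monotone

/-- The order comparing the `i`-th coordinates first, with ties broken lexicographically. -/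
def coordLexHom (i : Fin d) : (Fin d → ℚ) →+ ℚ ×ₗ Lex (Fin d → ℚ) where
  toFun w := toLex (w i, toLex w)
  map_zero' := rfl
  map_add' _ _ := rfl

theorem coordLexHom_injective (i : Fin d) : Function.Injective (coordLexHom i) := by
  intro a b hab
  have h1 := toLex.injective hab
  exact toLex.injective (Prod.ext_iff.1 h1).2

theorem coordLexHom_monotone (i : Fin d) : Monotone (coordLexHom i) := fun _ _ hab =>
  Prod.Lex.toLex_mono (Prod.mk_le_mk.2 ⟨hab i, Pi.toLex_monotone hab⟩)

/-- The exponents are only partially ordered, but the leading coefficients for the lexicographic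
order multiply. -/
instance : NoZeroDivisors (QSeries K d) where
  eq_zero_or_eq_zero_of_mul_eq_zero := by
    intro F G h
    by_contra! hne
    obtain ⟨a, ha, ha'⟩ := exists_minimal_exponent lexHom_monotone hne.1
    obtain ⟨b, hb, hb'⟩ := exists_minimal_exponent lexHom_monotone hne.2
    have := coeff_mul_of_minimal lexHom_injective ha' hb'
    rw [h, HahnSeries.coeff_zero] at this
    exact mul_ne_zero ha hb this.symm

instance : IsDomain (QSeries K d) := NoZeroDivisors.to_isDomain _

/-- A divisor of a monomial times a unit is again a monomial times a unit: the smallest `i`-th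
coordinates of the exponents of the two factors add up, for every `i`. -/
theorem IsDominant.exists_of_mul {F G : QSeries K d} {δ : Fin d → ℚ}
    (h : IsDominant (F * G) δ) : ∃ w, IsDominant F w := by
  have hF : F ≠ 0 := by rintro rfl; exact h.1 (by simp)
  have hG : G ≠ 0 := by rintro rfl; exact h.1 (by simp)
  choose x hx hx' using fun i => exists_minimal_exponent (coordLexHom_monotone i) hF
  choose y hy hy' using fun i => exists_minimal_exponent (coordLexHom_monotone i) hG
  have hfst : ∀ {i : Fin d} {a b : Fin d → ℚ}, coordLexHom i a ≤ coordLexHom i b → a i ≤ b i := by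
    intro i a b hab
    rcases Prod.Lex.toLex_le_toLex.1 hab with h1 | h1
    · exact h1.le
    · exact h1.1.le
  have hle : ∀ i, δ i ≤ x i i + y i i := fun i => by
    have h1 : (F * G).coeff (x i + y i) ≠ 0 := by
      rw [coeff_mul_of_minimal (coordLexHom_injective i) (hx' i) (hy' i)]
      exact mul_ne_zero (hx i) (hy i)
    exact h.2 _ h1 i
  have h0 := h.1
  rw [HahnSeries.coeff_mul] at h0
  obtain ⟨⟨a, b⟩, hab, hne⟩ := Finset.exists_ne_zero_of_sum_ne_zero h0
  obtain ⟨ha, hb, hs⟩ := Finset.mem_antidiagonal.1 hab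
  refine ⟨a, ha, fun w hw i => ?_⟩
  have h1 := hfst (hx' i w hw)
  have h2 := hfst (hy' i b hb)
  have h3 := congrFun hs i
  have h4 := hle i
  simp only [Pi.add_apply] at h3
  linarith

/-- If the dominant exponents of `x` and `y` were incomparable, both would occur in `x - y`, so its
dominant exponent would lie below both; but every exponent of `x - y` lies above one of them. -/
theorem IsDominant.le_or_le {x y : QSeries K d} {a b : Fin d → ℚ} (hx : IsDominant x a)
    (hy : IsDominant y b) (h : x - y = 0 ∨ ∃ c, IsDominant (x - y) c) : a ≤ b ∨ b ≤ a := by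
  rcases h with h | ⟨c, hc⟩
  · rw [sub_eq_zero] at h
    subst h
    exact Or.inl (hx.unique hy).le
  by_contra! hab
  have hya : y.coeff a = 0 := by
    by_contra h
    exact hab.2 (hy.2 a h)
  have hxb : x.coeff b = 0 := by
    by_contra h
    exact hab.1 (hx.2 b h)
  have hca : c ≤ a := hc.2 a (by rw [HahnSeries.coeff_sub, hya, sub_zero]; exact hx.1)
  have hcb : c ≤ b := hc.2 b (by rw [HahnSeries.coeff_sub, hxb, zero_sub, neg_ne_zero]; exact hy.1)
  have hc0 := hc.1
  rw [HahnSeries.coeff_sub] at hc0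
  by_cases h : x.coeff c = 0
  · rw [h, zero_sub, neg_ne_zero] at hc0
    exact hab.2 ((hy.2 c hc0).trans hca)
  · exact hab.1 ((hx.2 c h).trans hcb)

theorem isDominant_mono_mul {F : QSeries K d} (h0 : F.coeff 0 ≠ 0)
    (hF : ∀ w, F.coeff w ≠ 0 → 0 ≤ w) (a : Fin d → ℚ) : IsDominant (mono K a * F) a := by
  refine ⟨by rwa [mono_mul_coeff, sub_self], fun w hw => ?_⟩
  rw [mono_mul_coeff] at hw
  exact sub_nonneg.1 (hF _ hw)

variable {v : AbsoluteValue K ℝ}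

theorem coeff_zero_ne_zero_of_unit {Λ : AddSubmonoid (Fin d → ℚ)} (ε : (germRing K v Λ)ˣ) :
    ((ε : germRing K v Λ) : QSeries K d).coeff 0 ≠ 0 := by
  have h1 : ((ε : germRing K v Λ) : QSeries K d) *
      ((ε⁻¹ : (germRing K v Λ)ˣ) : germRing K v Λ) = 1 := by
    rw [← Subalgebra.coe_mul, Units.mul_inv, Subalgebra.coe_one]
  have h2 : (1 : QSeries K d).coeff 0 ≠ 0 := by simp [HahnSeries.coeff_one]
  rw [← h1, HahnSeries.coeff_mul] at h2
  obtain ⟨⟨a, b⟩, hab, hne⟩ := Finset.exists_ne_zero_of_sum_ne_zero h2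
  obtain ⟨ha, hb, hs⟩ := Finset.mem_antidiagonal.1 hab
  have ha0 := (ε.1.2.1 a ha).2
  have hb0 := ((ε⁻¹).1.2.1 b hb).2
  have : a = 0 := le_antisymm (by
    rw [← hs]; exact le_add_of_nonneg_right hb0) ha0
  rw [← this]
  exact ha

theorem isDominant_mono_mul_unit {Λ : AddSubmonoid (Fin d → ℚ)} (ε : (germRing K v Λ)ˣ)
    (a : Fin d → ℚ) : IsDominant (mono K a * ((ε : germRing K v Λ) : QSeries K d)) a :=
  isDominant_mono_mul (coeff_zero_ne_zero_of_unit ε) (fun w hw => (ε.1.2.1 w hw).2) a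

end Dominant

/-! ### Differences of roots -/

section Discriminant

/-- The difference of two distinct roots divides the discriminant: it divides `f'(x)`, and the
discriminant lies in the ideal `(f, f')`. -/
theorem exists_sub_mul_eq_discr {A R : Type*} [CommRing A] [CommRing R] [IsDomain R] [Algebra A R]
    {f : Polynomial A} (hf : f.Monic) {x y : R} (hx : Polynomial.aeval x f = 0)
    (hy : Polynomial.aeval y f = 0) (hxy : x ≠ y) :
    ∃ c, (x - y) * c = algebraMap A R f.discr := by
  have := (algebraMap A R).domain_nontrivial
  have hn : 0 < f.natDegree := by
    rw [Nat.pos_iff_ne_zero]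
    intro h0
    rw [hf.natDegree_eq_zero.1 h0] at hx
    simp at hx
  obtain ⟨p, q, -, -, hpq⟩ := Polynomial.exists_mul_add_mul_eq_C_resultant
    (m := f.natDegree) (n := f.natDegree - 1) f (Polynomial.derivative f) le_rfl
    (Polynomial.natDegree_derivative_le f) (Or.inl hn.ne')
  rw [Polynomial.resultant_deriv (Polynomial.natDegree_pos_iff_degree_pos.1 hn),
    hf.leadingCoeff, mul_one] at hpq
  have h1 := congrArg (Polynomial.aeval x) hpq
  rw [map_add, map_mul, map_mul, hx, zero_mul, zero_add, Polynomial.aeval_C, map_mul, map_pow,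
    map_neg, map_one] at h1
  set F := f.map (algebraMap A R) with hF
  have hxF : F.IsRoot x := by rwa [Polynomial.IsRoot, hF, Polynomial.eval_map_algebraMap]
  have hyF : F.eval y = 0 := by rwa [hF, Polynomial.eval_map_algebraMap]
  obtain ⟨s, hs⟩ := Polynomial.dvd_iff_isRoot.2 hxF
  have hsy : s.IsRoot y := by
    rw [hs, Polynomial.eval_mul] at hyF
    have : (Polynomial.X - Polynomial.C x).eval y ≠ 0 := by
      simpa [sub_eq_zero] using hxy.symm
    exact (mul_eq_zero.1 hyF).resolve_left this
  obtain ⟨t, ht⟩ := Polynomial.dvd_iff_isRoot.2 hsy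
  have hder : Polynomial.aeval x (Polynomial.derivative f) = (x - y) * t.eval x := by
    rw [← Polynomial.eval_map_algebraMap, ← Polynomial.derivative_map, ← hF, hs, ht]
    simp
  rw [hder] at h1
  set e : ℕ := f.natDegree * (f.natDegree - 1) / 2
  have he : ((-1 : R) ^ e) * (-1) ^ e = 1 := by
    rw [← mul_pow]; simp
  refine ⟨t.eval x * Polynomial.aeval x q * (-1) ^ e, ?_⟩
  calc _ = (x - y) * t.eval x * Polynomial.aeval x q * (-1) ^ e := by ring
    _ = ((-1) ^ e * (-1) ^ e) * algebraMap A R f.discr := by rw [h1]; ring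
    _ = _ := by rw [he, one_mul]

variable {K : Type*} [Field K] {v : AbsoluteValue K ℝ} {d : ℕ}

theorem IsQuasiOrdinary.isDominant_sub {f : Polynomial (fracRing K v d 1)}
    (hf : IsQuasiOrdinary v f) {x y : QSeries K d} (hx : Polynomial.aeval x f = 0)
    (hy : Polynomial.aeval y f = 0) : x - y = 0 ∨ ∃ c, IsDominant (x - y) c := by
  by_cases hxy : x = y
  · exact Or.inl (sub_eq_zero.2 hxy)
  obtain ⟨hmon, -, δ, ε, hδ⟩ := hf
  obtain ⟨c, hc⟩ := exists_sub_mul_eq_discr hmon hx hy hxy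
  have : IsDominant ((x - y) * c) (fun i => (δ i : ℚ)) := by
    rw [hc]
    change IsDominant (f.discr : QSeries K d) _
    rw [hδ]
    exact isDominant_mono_mul_unit ε _
  exact Or.inr this.exists_of_mul

end Discriminant

/-! ### Conjugate roots -/

section ConjugateRoots

variable {A B G : Type*} [CommRing A] [CommRing B] {i : A →+* B}

theorem map_of_forall_fixed (σ : B →+* B) (hσ : ∀ a, σ (i a) = i a) (f : Polynomial A) :
    (f.map i).map σ = f.map i := by
  rw [Polynomial.map_map]
  congr 1
  exact RingHom.ext hσ

theorem isRoot_of_forall_fixed (σ : B →+* B) (hσ : ∀ a, σ (i a) = i a) {f : Polynomial A} {z : B}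
    (hz : (f.map i).IsRoot z) : (f.map i).IsRoot (σ z) := by
  have := hz.map (f := σ)
  rwa [map_of_forall_fixed σ hσ] at this

/-- If a group acts on an extension domain `B` of `A` with ring of invariants `A`, then the roots
in `B` of an irreducible monic polynomial over `A` are conjugate: the product of `Y - z'` over the
distinct conjugates `z'` of a root has invariant coefficients, hence lies in `A[Y]`. -/
theorem exists_eq_of_isRoot_of_irreducible [IsDomain B] [AddGroup G]
    (hi : Function.Injective i) (σ : G → B →+* B) (hadd : ∀ k l z, σ (k + l) z = σ k (σ l z))
    (hzero : ∀ z, σ 0 z = z) (hfix : ∀ k a, σ k (i a) = i a)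
    (hinv : ∀ z, (∀ k, σ k z = z) → z ∈ Set.range i) {f : Polynomial A} (hmon : f.Monic)
    (hirr : Irreducible f) {z z' : B} (hz : (f.map i).IsRoot z) (hz' : (f.map i).IsRoot z') :
    ∃ k, σ k z = z' := by
  classical
  set F := f.map i with hF
  have hFmon : F.Monic := hmon.map _
  have hF0 : F ≠ 0 := hFmon.ne_zero
  set S : Finset B := F.roots.toFinset.filter fun s => ∃ k, σ k z = s with hS
  have memS : ∀ s, s ∈ S ↔ ∃ k, σ k z = s := by
    intro s
    rw [hS, Finset.mem_filter, Multiset.mem_toFinset, Polynomial.mem_roots hF0]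
    exact ⟨fun h => h.2, fun ⟨k, hk⟩ => ⟨hk ▸ isRoot_of_forall_fixed _ (hfix k) hz, k, hk⟩⟩
  set P : Polynomial B := ∏ s ∈ S, (Polynomial.X - Polynomial.C s) with hP
  have hPmon : P.Monic := Polynomial.monic_prod_X_sub_C (fun s => s) S
  have hPinv : ∀ k, P.map (σ k) = P := by
    intro k
    rw [hP, Polynomial.map_prod]
    simp only [Polynomial.map_sub, Polynomial.map_X, Polynomial.map_C]
    refine Finset.prod_nbij' (σ k) (σ (-k)) ?_ ?_ ?_ ?_ ?_
    · intro s hs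
      obtain ⟨l, rfl⟩ := (memS s).1 hs
      exact (memS _).2 ⟨k + l, hadd k l z⟩
    · intro s hs
      obtain ⟨l, rfl⟩ := (memS s).1 hs
      exact (memS _).2 ⟨-k + l, hadd (-k) l z⟩
    · intro s _
      rw [← hadd, neg_add_cancel, hzero]
    · intro s _
      rw [← hadd, add_neg_cancel, hzero]
    · intro s _
      rfl
  have hPlift : P ∈ Polynomial.lifts i := by
    rw [Polynomial.lifts_iff_coeff_lifts]
    intro m
    refine hinv _ fun k => ?_
    rw [← Polynomial.coeff_map, hPinv]
  obtain ⟨P₀, hP₀, -, hP₀mon⟩ := Polynomial.lifts_and_degree_eq_and_monic hPlift hPmon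
  have hdvd : P₀ ∣ f := by
    rw [← Polynomial.map_dvd_map i hi hP₀mon, hP₀]
    refine (Multiset.prod_X_sub_C_dvd_iff_le_roots hF0 S.val).2 ?_
    refine (Multiset.le_iff_subset S.nodup).2 fun s hs => ?_
    have : s ∈ S := hs
    rw [hS, Finset.mem_filter, Multiset.mem_toFinset] at this
    exact this.1
  have hzS : z ∈ S := (memS z).2 ⟨0, hzero z⟩
  have hnu : ¬ IsUnit P₀ := by
    intro hu
    rw [hP₀mon.isUnit_iff] at hu
    rw [hu, Polynomial.map_one] at hP₀
    have h1 : P.eval z = 0 := by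
      rw [hP, Polynomial.eval_prod]
      exact Finset.prod_eq_zero hzS (by simp)
    rw [← hP₀, Polynomial.eval_one] at h1
    exact one_ne_zero h1
  have hfP : F = P := by
    rw [← hP₀, hF]
    congr 1
    exact Polynomial.eq_of_monic_of_associated hmon hP₀mon
      ((hirr.dvd_iff.1 hdvd).resolve_left hnu)
  rw [hfP, Polynomial.IsRoot, hP, Polynomial.eval_prod, Finset.prod_eq_zero_iff] at hz'
  obtain ⟨s, hs, hs'⟩ := hz'
  rw [Polynomial.eval_sub, Polynomial.eval_X, Polynomial.eval_C, sub_eq_zero] at hs'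
  rw [hs']
  exact (memS s).1 hs

end ConjugateRoots

/-! ### Conjugation of fractional power series -/

section Conjugation

variable {K : Type*} [Field K] {v : AbsoluteValue K ℝ} {d n : ℕ} {η : K}

/-- The character `w ↦ η^{∑ k_i n w_i}` of the lattice `(1/n) ℤ^d`; off the lattice, where it is not
used, the exponents are rounded down. -/
def latticeChar (n : ℕ) (η : K) (k : Fin d → ℤ) (w : Fin d → ℚ) : K :=
  η ^ ∑ i, k i * ⌊(n : ℚ) * w i⌋

theorem floor_eq_of_mem {w : Fin d → ℚ} (hw : w ∈ fracLattice d n) (i : Fin d) :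
    ((⌊(n : ℚ) * w i⌋ : ℤ) : ℚ) = n * w i := by
  obtain ⟨k, hk⟩ := hw i
  rw [hk, Int.floor_intCast]

theorem latticeChar_add (hη : η ≠ 0) (k : Fin d → ℤ) {w w' : Fin d → ℚ}
    (hw : w ∈ fracLattice d n) (hw' : w' ∈ fracLattice d n) :
    latticeChar n η k (w + w') = latticeChar n η k w * latticeChar n η k w' := by
  rw [latticeChar, latticeChar, latticeChar, ← zpow_add₀ hη, ← Finset.sum_add_distrib]
  congr 1
  refine Finset.sum_congr rfl fun i _ => ?_
  rw [← mul_add]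
  congr 1
  have h1 := floor_eq_of_mem hw i
  have h2 := floor_eq_of_mem hw' i
  have h3 := floor_eq_of_mem (add_mem hw hw') i
  have : ((⌊(n : ℚ) * (w + w') i⌋ : ℤ) : ℚ) = ⌊(n : ℚ) * w i⌋ + ⌊(n : ℚ) * w' i⌋ := by
    rw [h1, h2, h3, Pi.add_apply, mul_add]
  exact_mod_cast this

theorem latticeChar_add_left (hη : η ≠ 0) (k l : Fin d → ℤ) (w : Fin d → ℚ) :
    latticeChar n η (k + l) w = latticeChar n η k w * latticeChar n η l w := by
  simp only [latticeChar, Pi.add_apply, add_mul, Finset.sum_add_distrib]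
  rw [zpow_add₀ hη]

theorem latticeChar_zero_right (k : Fin d → ℤ) : latticeChar n η k 0 = 1 := by
  simp [latticeChar]

theorem latticeChar_zero_left (w : Fin d → ℚ) : latticeChar n η 0 w = 1 := by
  simp [latticeChar]

theorem abv_latticeChar (hn : n ≠ 0) (hη : η ^ n = 1) (k : Fin d → ℤ) (w : Fin d → ℚ) :
    v (latticeChar n η k w) = 1 := by
  have h1 : v η = 1 := by
    have : v η ^ n = 1 := by rw [← map_pow, hη, map_one]
    exact (pow_eq_one_iff_of_nonneg (v.nonneg _) hn).1 this
  rw [latticeChar, map_zpow₀, h1, one_zpow]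

theorem latticeChar_of_integral (hη : η ^ n = 1) (k : Fin d → ℤ) {w : Fin d → ℚ}
    (hw : w ∈ fracLattice d 1) : latticeChar n η k w = 1 := by
  obtain ⟨a, rfl⟩ := mem_fracLattice_one.1 hw
  have : ∑ i, k i * ⌊(n : ℚ) * (a i : ℚ)⌋ = (n : ℤ) * ∑ i, k i * a i := by
    rw [Finset.mul_sum]
    refine Finset.sum_congr rfl fun i _ => ?_
    have : (n : ℚ) * (a i : ℚ) = ((n * a i : ℤ) : ℚ) := by push_cast; rfl
    rw [this, Int.floor_intCast]; ring
  rw [latticeChar, this, zpow_mul, zpow_natCast, hη, one_zpow]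

theorem integral_of_latticeChar (hn : n ≠ 0) (hη : IsPrimitiveRoot η n) {w : Fin d → ℚ}
    (hw : w ∈ fracLattice d n) (h : ∀ k, latticeChar n η k w = 1) : w ∈ fracLattice d 1 := by
  intro i
  have h1 := h (Pi.single i 1)
  have h2 : ∑ j, (Pi.single i 1 : Fin d → ℤ) j * ⌊(n : ℚ) * w j⌋ = ⌊(n : ℚ) * w i⌋ := by
    rw [Finset.sum_eq_single i]
    · simp
    · intro j _ hj; simp [hj]
    · simp
  rw [latticeChar, h2] at h1
  obtain ⟨c, hc⟩ := (hη.zpow_eq_one_iff_dvd _).1 h1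
  refine ⟨c, ?_⟩
  have h3 := floor_eq_of_mem hw i
  rw [hc] at h3
  push_cast at h3 ⊢
  rw [one_mul]
  exact (mul_left_cancel₀ (by exact_mod_cast hn) h3).symm

/-- The action `X^w ↦ χ_k(w) X^w` of the characters of `(1/n) ℤ^d / ℤ^d` on fractional power
series. -/
def conjHom (v : AbsoluteValue K ℝ) (d : ℕ) (hn : n ≠ 0) (hη : η ^ n = 1) (k : Fin d → ℤ) :
    fracRing K v d n →+* fracRing K v d n where
  toFun F := ⟨scaleCoeff (latticeChar n η k) F.val,
    fun w hw => F.2.1 w (right_ne_zero_of_mul hw),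
    F.2.2.scaleCoeff fun w => (abv_latticeChar hn hη k w).le⟩
  map_zero' := by
    refine Subtype.ext (HahnSeries.ext (funext fun w => ?_))
    simp
  map_one' := by
    refine Subtype.ext (HahnSeries.ext (funext fun w => ?_))
    by_cases hw : w = 0
    · simp [hw, latticeChar_zero_right]
    · simp [HahnSeries.coeff_one, hw]
  map_add' F G := by
    refine Subtype.ext (HahnSeries.ext (funext fun w => ?_))
    simp [mul_add]
  map_mul' F G := by
    have hη0 : η ≠ 0 := by
      rintro rfl
      rw [zero_pow hn] at hη
      exact zero_ne_one hη
    have hne : ∀ w, latticeChar n η k w ≠ 0 := fun w => by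
      intro h0
      have := abv_latticeChar (v := v) hn hη k w
      rw [h0, map_zero] at this
      exact zero_ne_one this
    refine Subtype.ext (HahnSeries.ext (funext fun w => ?_))
    change latticeChar n η k w * (F.val * G.val).coeff w =
      (scaleCoeff (latticeChar n η k) F.val * scaleCoeff (latticeChar n η k) G.val).coeff w
    rw [HahnSeries.coeff_mul, HahnSeries.coeff_mul, Finset.mul_sum]
    refine Finset.sum_congr ?_ fun x hx => ?_
    · ext x
      simp only [Finset.mem_antidiagonal, HahnSeries.mem_support, scaleCoeff_coeff, ne_eq,
        mul_eq_zero, hne, false_or]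
    · obtain ⟨h1, h2, rfl⟩ := Finset.mem_antidiagonal.1 hx
      rw [scaleCoeff_coeff, scaleCoeff_coeff,
        latticeChar_add hη0 k (F.2.1 _ (right_ne_zero_of_mul h1)).1
          (G.2.1 _ (right_ne_zero_of_mul h2)).1]
      ring

variable {hn : n ≠ 0} {hη : η ^ n = 1}

theorem conjHom_coeff (k : Fin d → ℤ) (F : fracRing K v d n) (w : Fin d → ℚ) :
    (conjHom v d hn hη k F).val.coeff w = latticeChar n η k w * F.val.coeff w := rfl

theorem conjHom_add (k l : Fin d → ℤ) (F : fracRing K v d n) :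
    conjHom v d hn hη (k + l) F = conjHom v d hn hη k (conjHom v d hn hη l F) := by
  have hη0 : η ≠ 0 := by
    rintro rfl
    rw [zero_pow hn] at hη
    exact zero_ne_one hη
  refine Subtype.ext (HahnSeries.ext (funext fun w => ?_))
  rw [conjHom_coeff, conjHom_coeff, conjHom_coeff, latticeChar_add_left hη0, mul_assoc]

theorem conjHom_zero (F : fracRing K v d n) : conjHom v d hn hη 0 F = F := by
  refine Subtype.ext (HahnSeries.ext (funext fun w => ?_))
  rw [conjHom_coeff, latticeChar_zero_left, one_mul]

theorem fracLattice_one_le (d n : ℕ) : fracLattice d 1 ≤ fracLattice d n := by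
  intro w hw i
  obtain ⟨a, rfl⟩ := mem_fracLattice_one.1 hw
  exact ⟨n * a i, by simp⟩

/-- The inclusion `K{X} ⊆ K{X^{1/n}}`. -/
def fracInclusion (v : AbsoluteValue K ℝ) (d n : ℕ) : fracRing K v d 1 →+* fracRing K v d n :=
  (Subalgebra.inclusion (germRing_mono v (AddSubgroup.toAddSubmonoid_mono
    (fracLattice_one_le d n)))).toRingHom

theorem fracInclusion_injective : Function.Injective (fracInclusion (K := K) v d n) :=
  Subalgebra.inclusion_injective _

theorem fracInclusion_val (F : fracRing K v d 1) : (fracInclusion v d n F).val = F.val := rfl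

theorem conjHom_fracInclusion (k : Fin d → ℤ) (F : fracRing K v d 1) :
    conjHom v d hn hη k (fracInclusion v d n F) = fracInclusion v d n F := by
  refine Subtype.ext (HahnSeries.ext (funext fun w => ?_))
  rw [conjHom_coeff, fracInclusion_val]
  by_cases hw : F.val.coeff w = 0
  · rw [hw, mul_zero]
  · rw [latticeChar_of_integral hη k (F.2.1 w hw).1, one_mul]

theorem mem_range_fracInclusion (hprim : IsPrimitiveRoot η n) {F : fracRing K v d n}
    (hF : ∀ k, conjHom v d hn hη k F = F) : F ∈ Set.range (fracInclusion v d n) := by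
  refine ⟨⟨F.val, fun w hw => ⟨?_, (F.2.1 w hw).2⟩, F.2.2⟩, rfl⟩
  refine integral_of_latticeChar hn hprim (F.2.1 w hw).1 fun k => ?_
  have h1 := congrArg (fun G : fracRing K v d n => G.val.coeff w) (hF k)
  simp only [conjHom_coeff] at h1
  exact mul_right_cancel₀ hw (h1.trans (one_mul _).symm)

theorem isRoot_conjHom (k : Fin d → ℤ) {f : Polynomial (fracRing K v d 1)}
    {z : fracRing K v d n} (hz : (f.map (fracInclusion v d n)).IsRoot z) :
    (f.map (fracInclusion v d n)).IsRoot (conjHom v d hn hη k z) :=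
  isRoot_of_forall_fixed _ (conjHom_fracInclusion k) hz

/-- The roots of an irreducible polynomial in `K{X^{1/n}}` are conjugate. -/
theorem exists_conjHom_eq_of_isRoot (hprim : IsPrimitiveRoot η n)
    {f : Polynomial (fracRing K v d 1)} (hmon : f.Monic) (hirr : Irreducible f)
    {z z' : fracRing K v d n} (hz : (f.map (fracInclusion v d n)).IsRoot z)
    (hz' : (f.map (fracInclusion v d n)).IsRoot z') : ∃ k, conjHom v d hn hη k z = z' := by
  have hadd := @conjHom_add K _ v d n η hn hη
  have hzero := @conjHom_zero K _ v d n η hn hη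
  have hfix := @conjHom_fracInclusion K _ v d n η hn hη
  have hinv := fun F => @mem_range_fracInclusion K _ v d n η hn hη hprim F
  have hinj := @fracInclusion_injective K _ v d n
  have hconj := exists_eq_of_isRoot_of_irreducible hinj (conjHom v d hn hη) hadd hzero hfix hinv
    hmon hirr hz hz'
  exact hconj

theorem isRoot_iff_aeval (f : Polynomial (fracRing K v d 1)) (z : fracRing K v d n) :
    (f.map (fracInclusion v d n)).IsRoot z ↔ Polynomial.aeval z.val f = 0 := by
  rw [Polynomial.IsRoot, Polynomial.eval_map]
  have h := Polynomial.hom_eval₂ f (fracInclusion v d n) (fracRing K v d n).val.toRingHom z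
  have e : Polynomial.aeval z.val f =
      (Polynomial.eval₂ (fracInclusion v d n) z f : fracRing K v d n).val := h.symm
  rw [e]
  exact ⟨fun h => by rw [h]; rfl, fun h => Subtype.ext h⟩

end Conjugation

/-! ### The characteristic exponents form a chain -/

section CharExponents

variable {K : Type*} [Field K] {v : AbsoluteValue K ℝ} {d : ℕ}

theorem exists_isPrimitiveRoot [IsAlgClosed K] [CharZero K] {n : ℕ} (hn : n ≠ 0) :
    ∃ η : K, IsPrimitiveRoot η n := by
  have : NeZero (n : K) := ⟨by exact_mod_cast hn⟩
  obtain ⟨η, h⟩ := IsAlgClosed.exists_root (Polynomial.cyclotomic n K)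
    (Polynomial.degree_cyclotomic_pos n K (Nat.pos_of_ne_zero hn)).ne'
  exact ⟨η, Polynomial.isRoot_cyclotomic_iff.1 h⟩

theorem natDegree_ne_zero_of_irreducible {A : Type*} [CommRing A] {f : Polynomial A}
    (hmon : f.Monic) (hirr : Irreducible f) : f.natDegree ≠ 0 := fun h0 =>
  hirr.not_isUnit (by rw [hmon.natDegree_eq_zero.1 h0]; exact isUnit_one)

variable {f : Polynomial (fracRing K v d 1)}

/-- A difference of two of the finitely many roots has at most one dominant exponent. -/
theorem finite_charExponents (hf : IsQuasiOrdinary v f) : (charExponents v f).Finite := by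
  classical
  have hroots : {z : QSeries K d | Polynomial.aeval z f = 0}.Finite := by
    refine (f.map (algebraMap _ (QSeries K d))).roots.toFinset.finite_toSet.subset fun z hz => ?_
    rw [Finset.mem_coe, Multiset.mem_toFinset, Polynomial.mem_roots (hf.1.map _).ne_zero,
      Polynomial.IsRoot, Polynomial.eval_map_algebraMap]
    exact hz
  refine ((hroots.prod hroots).biUnion (t := fun p => {w | IsDominant (p.1 - p.2) w})
    fun p _ => Set.Subsingleton.finite fun a ha b hb => ha.unique hb).subset ?_
  rintro w ⟨x, -, y, -, hx0, hy0, ε, hε⟩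
  refine Set.mem_biUnion (x := (x, y)) ⟨hx0, hy0⟩ ?_
  change IsDominant (x - y) w
  rw [hε]
  exact isDominant_mono_mul_unit ε w

variable [IsAlgClosed K] [CharZero K]

theorem pos_of_mem_charExponents (hf : IsQuasiOrdinary v f) (hirr : Irreducible f)
    {w : Fin d → ℚ} (hw : w ∈ charExponents v f) : 0 < w := by
  obtain ⟨x, hx, y, hy, hx0, hy0, ε, hε⟩ := hw
  have hn := natDegree_ne_zero_of_irreducible hf.1 hirr
  obtain ⟨η, hη⟩ := exists_isPrimitiveRoot (K := K) hn
  have hdom : IsDominant (x - y) w := by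
    rw [hε]; exact isDominant_mono_mul_unit ε w
  have hw0 : 0 ≤ w := by
    have := hdom.1
    rw [HahnSeries.coeff_sub] at this
    by_cases hxw : x.coeff w = 0
    · rw [hxw, zero_sub, neg_ne_zero] at this
      exact (hy.1 w this).2
    · exact (hx.1 w hxw).2
  refine lt_of_le_of_ne hw0 ?_
  rintro rfl
  -- conjugation does not change the constant term
  obtain ⟨k, hk⟩ := exists_conjHom_eq_of_isRoot (hn := hn) (hη := hη.pow_eq_one) hη hf.1 hirr
    ((isRoot_iff_aeval f ⟨x, hx⟩).2 hx0) ((isRoot_iff_aeval f ⟨y, hy⟩).2 hy0)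
  have h1 := congrArg (fun G : fracRing K v d f.natDegree => G.val.coeff 0) hk
  simp only [conjHom_coeff, latticeChar_zero_right, one_mul] at h1
  exact hdom.1 (by rw [HahnSeries.coeff_sub, h1, sub_self])

/-- Two differences of roots are made to share a root by conjugation; then their difference is again
a difference of roots. -/
theorem isChain_charExponents (hf : IsQuasiOrdinary v f) (hirr : Irreducible f) :
    IsChain (· ≤ ·) (charExponents v f) := by
  rintro w ⟨x, hx, y, hy, hx0, hy0, ε, hε⟩ w' ⟨x', hx', y', hy', hx0', hy0', ε', hε'⟩ -
  have hn := natDegree_ne_zero_of_irreducible hf.1 hirr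
  obtain ⟨η, hη⟩ := exists_isPrimitiveRoot (K := K) hn
  obtain ⟨k, hk⟩ := exists_conjHom_eq_of_isRoot (hn := hn) (hη := hη.pow_eq_one) hη hf.1 hirr
    ((isRoot_iff_aeval f ⟨x', hx'⟩).2 hx0') ((isRoot_iff_aeval f ⟨x, hx⟩).2 hx0)
  set σ := conjHom v d hn hη.pow_eq_one k with hσ
  have hdom : IsDominant (x - y) w := by
    rw [hε]; exact isDominant_mono_mul_unit ε w
  have hdom' : IsDominant (x' - y') w' := by
    rw [hε']; exact isDominant_mono_mul_unit ε' w'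
  -- after conjugation both differences involve the root `x`
  have hval : ∀ u, (x - (σ ⟨y', hy'⟩).val).coeff u =
      latticeChar f.natDegree η k u * (x' - y').coeff u := by
    intro u
    have h1 : x = (σ ⟨x', hx'⟩).val := by rw [hk]
    rw [h1, HahnSeries.coeff_sub, conjHom_coeff, conjHom_coeff, HahnSeries.coeff_sub, mul_sub]
  have hchar : ∀ u, latticeChar f.natDegree η k u ≠ 0 := fun u h0 => by
    have := abv_latticeChar (v := v) hn hη.pow_eq_one k u
    rw [h0, map_zero] at this
    exact zero_ne_one this
  have hdom2 : IsDominant (x - (σ ⟨y', hy'⟩).val) w' := by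
    refine ⟨by rw [hval]; exact mul_ne_zero (hchar _) hdom'.1, fun u hu => ?_⟩
    rw [hval] at hu
    exact hdom'.2 u (right_ne_zero_of_mul hu)
  refine hdom.le_or_le hdom2 ?_
  have e : x - y - (x - (σ ⟨y', hy'⟩).val) = (σ ⟨y', hy'⟩).val - y := by abel
  rw [e]
  exact hf.isDominant_sub ((isRoot_iff_aeval f _).1
    (isRoot_conjHom k ((isRoot_iff_aeval f ⟨y', hy'⟩).2 hy0'))) hy0

theorem exists_strictMono_range_eq {α : Type*} [PartialOrder α] {s : Set α} (hs : s.Finite)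
    (hc : IsChain (· ≤ ·) s) : ∃ (g : ℕ) (a : Fin g → α), StrictMono a ∧ Set.range a = s := by
  classical
  have := hs.fintype
  let _ : LinearOrder s :=
    { (inferInstance : PartialOrder s) with
      le_total := fun a b => hc.total a.2 b.2
      toDecidableLE := Classical.decRel _ }
  refine ⟨Fintype.card s, fun i => (monoEquivOfFin s rfl i : α), fun i j hij => ?_, ?_⟩
  · exact (monoEquivOfFin s rfl).strictMono hij
  · ext x
    constructor
    · rintro ⟨i, rfl⟩
      exact Subtype.prop _
    · intro hx
      exact ⟨(monoEquivOfFin s rfl).symm ⟨x, hx⟩, by simp⟩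

end CharExponents

end QuasiOrdinary

end

theorem mainTheorem5 {K : Type*} [Field K] [IsAlgClosed K] [CharZero K]
    (v : AbsoluteValue K ℝ) {d : ℕ}
    (f : Polynomial (QuasiOrdinary.fracRing K v d 1))
    (hf : QuasiOrdinary.IsQuasiOrdinary v f) (hirr : Irreducible f) :
    ∃ (g : ℕ) (lam : Fin g → Fin d → ℚ),
      -- `lam` lists the characteristic exponents `λ_1 ≺ ⋯ ≺ λ_g` of `f`
      StrictMono lam ∧ Set.range lam = QuasiOrdinary.charExponents v f ∧
      -- `γ_0` is the minimal Frobenius vector of `Γ`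
      QuasiOrdinary.IsMinimalFrobeniusVector lam (QuasiOrdinary.gammaZero lam) ∧
      -- `Jac(Z^Γ) = X^{γ_0} J_log(Z^Γ)` for the affine toric variety `Z^Γ`
      (QuasiOrdinary.coordInclusion K lam '' (QuasiOrdinary.affineJacobian K lam) =
        (fun h => AddMonoidAlgebra.single (QuasiOrdinary.gammaZero lam) (1 : K) *
          QuasiOrdinary.coordInclusion K lam h) '' (QuasiOrdinary.affineLogJacobian K lam)) ∧
      -- `Jac(S_0) O_Z = X^{γ_0} I_g`
      (Subtype.val '' (((QuasiOrdinary.germJacobian v lam).map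
          (QuasiOrdinary.normalization v lam) : Ideal (QuasiOrdinary.normalizedGerm v lam)) :
            Set (QuasiOrdinary.normalizedGerm v lam)) =
        QuasiOrdinary.monoMul v lam (QuasiOrdinary.gammaZero lam)
          (QuasiOrdinary.monomialIdeal v lam)) ∧
      -- `Jac(S_0) O_Z = X^{γ_0} J_log(S_0) O_Z`
      (∀ u : Module.Basis (Fin d) ℚ (Fin d → ℚ), QuasiOrdinary.IsLatticeBasis lam u →
        Subtype.val '' (((QuasiOrdinary.germJacobian v lam).map
          (QuasiOrdinary.normalization v lam) : Ideal (QuasiOrdinary.normalizedGerm v lam)) :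
            Set (QuasiOrdinary.normalizedGerm v lam)) =
        QuasiOrdinary.monoMul v lam (QuasiOrdinary.gammaZero lam)
          (QuasiOrdinary.germLogJacobian v lam u)) := by
  obtain ⟨g, lam, hmono, hrange⟩ := QuasiOrdinary.exists_strictMono_range_eq
    (QuasiOrdinary.finite_charExponents hf) (QuasiOrdinary.isChain_charExponents hf hirr)
  have h : QuasiOrdinary.IsExponentChain lam :=
    ⟨hmono.monotone, fun j => QuasiOrdinary.pos_of_mem_charExponents hf hirr
      (hrange ▸ Set.mem_range_self j)⟩
  refine ⟨g, lam, hmono, hrange, h.isMinimalFrobeniusVector_gammaZero, h.image_affineJacobian,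
    h.image_germJacobian, fun u _ => ?_⟩
  rw [h.germLogJacobian_eq u]
  exact h.image_germJacobian
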